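/- **Conventions.** Graphs are simplicial, and $d$ is the path metric on the vertices of a connected graph. A connected graph is *hyperbolic* if it is Gromov hyperbolic. It is *fine* if for each edge $e$ and each $n$ only finitely many circuits of length $n$ contain $e$. A subgraph $H\subset K$ is *convex* if every geodesic of $K$ between two vertices of $H$ lies in $H$. A set $S$ of vertices *separates* $K$ if the graph $K\setminus S$ (delete $S$ and all edges meeting it) is disconnected. A closed subset $S$ of a space $M$ *separates* $M$ if $M\setminus S$ is disconnected. Let $G$ be a finitely generated group, $\Lambda$ a $G$-set, and $\mathcal P=(\mathrm{Stab}(x))_{x\in\Lambda}$. A *$(G,\mathcal P)$-graph* is a connected, fine, hyperbolic graph $K$ with vertex set $\Lambda$ on which $G$ acts (extending the action on $\Lambda$) with finite quotient, finite edge stabilizers and finitely generated vertex stabilizers. The pair $(G,\mathcal P)$ is *relatively hyperbolic* if a $(G,\mathcal P)$-graph exists. The Bowditch boundary is then $\partial(G,\mathcal P)=\Delta K=\Lambda\sqcup\partial K$, where $\partial K$ is the Gromov boundary (asymptotic classes of geodesic rays), topologized so that the sets $M(x,A)$, $A\subset\Lambda$ finite, form a neighbourhood base at $x\in\Delta K$;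 here $M(x,A)$ is the set of $y\in\Delta K$ such that every geodesic from $x$ to $y$ misses $A\setminus\{x\}$. **Admissible actions.** Let $G$ be a finitely generated group acting without inversions and with finite quotient on a countable tree $T$ that is bipartite with colour classes $V$ (white) and $W$ (red), preserving the colours, every vertex having valence at least $2$. Write $G_u$ for the stabilizer of a vertex $u$. Suppose that for each vertex $u$ we are given a $G_u$-set $\Lambda_u$, with $G$ acting on $\Lambda=\bigsqcup_u\Lambda_u$ so that $g$ maps $\Lambda_u$ bijectively onto $\Lambda_{gu}$ and the restricted action of $G_u$ on $\Lambda_u$ is the given one. Suppose that $(G_u,\mathcal P_u)$ is relatively hyperbolic for every $u$ (in particular $G_u$ is finitely generated), where $\mathcal P_u=(\mathrm{Stab}_{G_u}(x))_{x\in\Lambda_u}$. Suppose that for each $w\in W$ we have $1\le|\Lambda_w|<\infty$, with $G_w$ finite if $|\Lambda_w|>1$. The action is then *admissible*. It is *$2$-admissible* if moreover $|\Lambda_w|=2$ for all $w\in W$. **Signatures.** A *signature* $\mathcal S$ is a family of injections $s_e:\Lambda_w\to\Lambda_v$, one for each edge $e=(v,w)$ of $T$ with $v\in V$, $w\in W$,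 such that $s_{ge}(gx)=g\,s_e(x)$ for all $g\in G$, $x\in\Lambda_w$, and such that $|\mathrm{Im}(s_e)\cap\mathrm{Im}(s_{e'})|\le1$ for distinct edges $e,e'$. The *parabolic forest* $F$ of $\mathcal S$ is the graph with vertex set $\Lambda$ and with an edge between $x$ and $s_e(x)$ for each edge $e=(v,w)$ and each $x\in\Lambda_w$; its components are the *parabolic trees*. Let $\equiv$ be the equivalence relation on $\Lambda$ generated by $x\equiv s_e(x)$, let $\bar\Lambda=\Lambda/{\equiv}$ with the induced $G$-action, and let $\mathcal P=(\mathrm{Stab}(x))_{x\in\bar\Lambda}$. A *neck* in $\Lambda_v$ ($v\in V$) is a pair $\{s_e(x),s_e(y)\}$ with $e=(v,w)$ and $x\ne y$ in $\Lambda_w$. **Vertex graphs.** A *system of vertex graphs* is a $G$-equivariant family $(K_u)_u$ in which $K_u$ has vertex set $\Lambda_u$; for $v\in V$, $K_v$ is a $(G_v,\mathcal P_v)$-graph in which the two points of each neck are adjacent (a *reservoir*); and for $w\in W$, $K_w$ is the complete graph on $\Lambda_w$ (a single edge if $|\Lambda_w|=2$). Let $\bar K$ be the graph with vertex set $\bar\Lambda$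 in which two distinct classes are adjacent if and only if they have representatives adjacent in some $K_u$ by an edge that is not a neck. **Theorem.** Let $G$ act on $T$ with a $2$-admissible action and let $\mathcal S$ be a signature for this action. Then: 1. $(G,\mathcal P)$ is relatively hyperbolic. Systems of vertex graphs exist, and for each of them $\bar K$ is a $(G,\mathcal P)$-graph. 2. For each system of vertex graphs and each vertex $u$ of $T$, the natural map $\Lambda_u\to\bar\Lambda$ is injective and identifies $K_u$ with a convex subgraph of $\bar K$. 3. $F$ is a forest, and $x\mapsto$ (the parabolic tree containing $x$) induces a $G$-equivariant bijection from $\bar\Lambda$ to the set of parabolic trees of $F$; thus $\mathcal P$ is the family of the stabilizers of the parabolic trees. 4. For each system of vertex graphs, if the Bowditch boundary $\partial(G,\mathcal P)=\Delta\bar K$ is connected, then for each $w\in W$ the image of $\Lambda_w$ in $\bar\Lambda$ separates both $\bar K$ and $\partial(G,\mathcal P)$. -/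

import Mathlib

open MulAction

namespace ParabolicCombination

/-! ### Graphs: hyperbolicity, fineness, geodesics and the space `Δ K` -/

section Graphs

variable {X : Type*}

/-- Gromov hyperbolicity of (the vertex set of) a graph: the four-point condition. -/
def Hyperbolic (K : SimpleGraph X) : Prop :=
  ∃ δ : ℕ, ∀ x y z t : X,
    K.dist x y + K.dist z t ≤ max (K.dist x z + K.dist y t) (K.dist x t + K.dist y z) + δ

/-- A graph is fine if every edge lies in only finitely many circuits of each length.
Circuits are recorded here with a base vertex and a direction; a circuit of length `n` has
exactly `2 * n` such records, so this does not affect finiteness. -/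
def Fine (K : SimpleGraph X) : Prop :=
  ∀ e ∈ K.edgeSet, ∀ n : ℕ,
    {c : Σ x : X, K.Walk x x | c.2.IsCycle ∧ c.2.length = n ∧ e ∈ c.2.edges}.Finite

/-- Geodesic rays, as sequences of vertices. -/
def GeodesicRay (K : SimpleGraph X) : Type _ :=
  {r : ℕ → X // ∀ i j : ℕ, i ≤ j → K.dist (r i) (r j) = j - i}

/-- Two geodesic rays are asymptotic if they stay at bounded distance. -/
def asymptotic (K : SimpleGraph X) : Setoid (GeodesicRay K) where
  r p q := ∃ C : ℕ, ∀ n : ℕ, K.edist (p.1 n) (q.1 n) ≤ C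
  iseqv :=
    { refl := fun p => ⟨0, fun n => by simp⟩
      symm := fun ⟨C, h⟩ => ⟨C, fun n => by rw [SimpleGraph.edist_comm]; exact h n⟩
      trans := fun ⟨C, h⟩ ⟨D, k⟩ => ⟨C + D, fun n => by
        push_cast
        exact SimpleGraph.edist_triangle.trans (add_le_add (h n) (k n))⟩ }

/-- The Gromov boundary `∂ K`: asymptotic classes of geodesic rays. -/
def GromovBoundary (K : SimpleGraph X) : Type _ := Quotient (asymptotic K)

/-- Bi-infinite geodesics, as sequences of vertices. -/
def GeodesicLine (K : SimpleGraph X) : Type _ :=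
  {l : ℤ → X // ∀ i j : ℤ, i ≤ j → (K.dist (l i) (l j) : ℤ) = j - i}

/-- The half of a bi-infinite geodesic over the nonnegative integers. -/
def GeodesicLine.pos {K : SimpleGraph X} (l : GeodesicLine K) : GeodesicRay K :=
  ⟨fun n => l.1 n, fun i j h => by
    have := l.2 i j (by exact_mod_cast h)
    show K.dist (l.1 i) (l.1 j) = j - i
    omega⟩

/-- The half of a bi-infinite geodesic over the nonpositive integers. -/
def GeodesicLine.neg {K : SimpleGraph X} (l : GeodesicLine K) : GeodesicRay K :=
  ⟨fun n => l.1 (-n), fun i j h => by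
    have := l.2 (-j) (-i) (by omega)
    show K.dist (l.1 (-i)) (l.1 (-j)) = j - i
    rw [SimpleGraph.dist_comm]
    omega⟩

/-- The set `Δ K`, the disjoint union of the vertex set and the Gromov boundary. -/
inductive Delta (K : SimpleGraph X) : Type _
  | vertex (a : X) : Delta K
  | ideal (ξ : GromovBoundary K) : Delta K

/-- `GeodesicVertices K x y S`: the set `S` consists of the vertices of some geodesic from `x`
to `y`, where `x` and `y` are vertices or points at infinity. -/
inductive GeodesicVertices (K : SimpleGraph X) : Delta K → Delta K → Set X → Prop
  | segment {a b : X} (p : K.Walk a b) (hp : p.length = K.dist a b) :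
      GeodesicVertices K (.vertex a) (.vertex b) {c | c ∈ p.support}
  | ray (r : GeodesicRay K) :
      GeodesicVertices K (.vertex (r.1 0)) (.ideal (Quotient.mk _ r)) (Set.range r.1)
  | rayBack (r : GeodesicRay K) :
      GeodesicVertices K (.ideal (Quotient.mk _ r)) (.vertex (r.1 0)) (Set.range r.1)
  | line (l : GeodesicLine K) :
      GeodesicVertices K (.ideal (Quotient.mk _ l.neg)) (.ideal (Quotient.mk _ l.pos))
        (Set.range l.1)

/-- `M(x, A)`: all points `y` of `Δ K` such that every geodesic from `x` to `y` misses
`A \ {x}`. -/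
def Delta.M {K : SimpleGraph X} (x : Delta K) (A : Set X) : Set (Delta K) :=
  {y | ∀ S, GeodesicVertices K x y S → ∀ a ∈ S, a ∈ A → Delta.vertex a = x}

/-- The topology on `Δ K` in which the sets `M(x, A)`, for `A` a finite set of vertices, are a
base of neighbourhoods at `x`. -/
instance (K : SimpleGraph X) : TopologicalSpace (Delta K) where
  IsOpen O := ∀ x ∈ O, ∃ A : Set X, A.Finite ∧ x.M A ⊆ O
  isOpen_univ := fun _ _ => ⟨∅, Set.finite_empty, Set.subset_univ _⟩
  isOpen_inter := fun O O' h h' x hx => by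
    obtain ⟨A, hA, hAO⟩ := h x hx.1
    obtain ⟨B, hB, hBO⟩ := h' x hx.2
    exact ⟨A ∪ B, hA.union hB, fun y hy =>
      ⟨hAO fun S hS a ha haA => hy S hS a ha (Or.inl haA),
        hBO fun S hS a ha haB => hy S hS a ha (Or.inr haB)⟩⟩
  isOpen_sUnion := fun s h x ⟨O, hO, hx⟩ => by
    obtain ⟨A, hA, hAO⟩ := h O hO x hx
    exact ⟨A, hA, hAO.trans (Set.subset_sUnion_of_mem hO)⟩

/-- A set of vertices is separating if deleting it (with all incident edges) leaves a
disconnected graph. -/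
def SeparatesGraph (K : SimpleGraph X) (S : Set X) : Prop :=
  ¬ (K.induce Sᶜ).Preconnected

/-- A closed subset of a space is separating if its complement is disconnected. -/
def SeparatesSpace {M : Type*} [TopologicalSpace M] (S : Set M) : Prop :=
  IsClosed S ∧ ¬ IsPreconnected Sᶜ

/-- Via `f`, the graph `H` is a convex subgraph of `K`: `f` identifies `H` with the subgraph of
`K` spanned by the image of `f`, and every geodesic of `K` between two vertices of the image
stays in the image. -/
def IsConvexSubgraph {Y : Type*} (H : SimpleGraph Y) (K : SimpleGraph X) (f : Y → X) : Prop :=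
  Function.Injective f ∧ (∀ a b, K.Adj (f a) (f b) ↔ H.Adj a b) ∧
    ∀ (a b : Y) (p : K.Walk (f a) (f b)), p.length = K.dist (f a) (f b) →
      ∀ c ∈ p.support, c ∈ Set.range f

end Graphs

/-! ### Group actions on graphs and relatively hyperbolic groups -/

section RelativelyHyperbolic

variable (G : Type*) [Group G] {X : Type*} [MulAction G X]

/-- `G` acts on the graph `K` by automorphisms. -/
def ActsOn (K : SimpleGraph X) : Prop :=
  ∀ (g : G) (x y : X), K.Adj x y → K.Adj (g • x) (g • y)

/-- The quotient of `K` by `G` is a finite graph: there are finitely many orbits of vertices and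
of (oriented) edges. -/
def FiniteQuotient (K : SimpleGraph X) : Prop :=
  (∃ R : Set X, R.Finite ∧ ∀ x, ∃ y ∈ R, ∃ g : G, g • y = x) ∧
    ∃ R : Set (X × X), R.Finite ∧ ∀ x y, K.Adj x y → ∃ e ∈ R, ∃ g : G, g • e = (x, y)

/-- `K` is a `(G, 𝒫)` graph, where `X` is a `G`-set and `𝒫` is the family of the stabilizers of
the elements of `X`. -/
structure IsPeripheralGraph (K : SimpleGraph X) : Prop where
  actsOn : ActsOn G K
  finiteQuotient : FiniteQuotient G K
  connected : K.Connected
  fine : Fine K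
  hyperbolic : Hyperbolic K
  finite_edge_stabilizer : ∀ x y, K.Adj x y → {g : G | s(g • x, g • y) = s(x, y)}.Finite
  fg_vertex_stabilizer : ∀ x : X, (stabilizer G x).FG

variable (X) in
/-- The pair `(G, 𝒫)` is relatively hyperbolic, where `X` is a `G`-set and `𝒫` is the family of
the stabilizers of the elements of `X`. -/
def RelativelyHyperbolic : Prop :=
  Group.FG G ∧ ∃ K : SimpleGraph X, IsPeripheralGraph G K

end RelativelyHyperbolic

/-! ### Admissible actions and signatures -/

section Fibers

variable {G U L : Type*} [Group G] [MulAction G U] [MulAction G L]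

/-- The fibre of an equivariant map over `u`. -/
def Fiber (π : L →[G] U) (u : U) : Type _ := {x : L // π x = u}

/-- Translation by `g` as a map from the fibre over `u` to the fibre over `g • u`. -/
def Fiber.translate {π : L →[G] U} {u : U} (g : G) (x : Fiber π u) : Fiber π (g • u) :=
  ⟨g • x.1, by rw [map_smul, x.2]⟩

/-- The stabilizer of `u` acts on the fibre over `u`. -/
instance (π : L →[G] U) (u : U) : MulAction (stabilizer G u) (Fiber π u) where
  smul g x := ⟨g.1 • x.1, by rw [map_smul, x.2]; exact g.2⟩
  one_smul x := Subtype.ext (one_smul G x.1)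
  mul_smul g h x := Subtype.ext (mul_smul g.1 h.1 x.1)

end Fibers

/-- An admissible action of the finitely generated group `G` on a countable tree with vertex set
`U`. The sets `Λ_u` are given as the fibres of an equivariant map from the `G`-set `L`, their
disjoint union, to `U`: the stabilizer of `u` acts on `Λ_u`, and each `g` in `G` gives a bijection
from `Λ_u` to `Λ_{g u}` that is equivariant with respect to conjugation by `g`. -/
structure AdmissibleAction (G U L : Type*) [Group G] [MulAction G U] [MulAction G L] where
  fg : Group.FG G
  /-- the tree -/
  T : SimpleGraph U
  countable : Countable U
  isTree : T.IsTree
  actsOn : ActsOn G T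
  no_inversion : ∀ (g : G) (u u' : U), T.Adj u u' → ¬ (g • u = u' ∧ g • u' = u)
  finiteQuotient : FiniteQuotient G T
  /-- one colour class (white) -/
  V : Set U
  /-- the other colour class (red) -/
  W : Set U
  union_eq : V ∪ W = Set.univ
  bipartite : T.IsBipartiteWith V W
  /-- the action preserves the colours -/
  smul_mem_V : ∀ (g : G), ∀ v ∈ V, g • v ∈ V
  smul_mem_W : ∀ (g : G), ∀ w ∈ W, g • w ∈ W
  valence : ∀ u : U, (T.neighborSet u).Nontrivial
  /-- the sets `Λ_u` -/
  π : L →[G] U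
  relativelyHyperbolic : ∀ u : U, RelativelyHyperbolic (stabilizer G u) (Fiber π u)
  nonempty : ∀ w ∈ W, Nonempty (Fiber π w)
  finite : ∀ w ∈ W, Finite (Fiber π w)
  finite_stabilizer : ∀ w ∈ W, Nontrivial (Fiber π w) → Finite (stabilizer G w)

variable {G U L : Type*} [Group G] [MulAction G U] [MulAction G L]

/-- The action is `n`-admissible if `Λ_w` has exactly `n` elements for each red vertex `w`. -/
def AdmissibleAction.IsNAdmissible (A : AdmissibleAction G U L) (n : ℕ) : Prop :=
  ∀ w ∈ A.W, Nat.card (Fiber A.π w) = n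

/-- A signature of an admissible action: a family of injections `s_e : Λ_w → Λ_v`, one for each
edge `e = (v, w)` with `w` red (and so `v` white). The condition `g s_e(x) = s_e(g x)` for `g`
fixing `v` and `w` is the special case of `equivariant` where `g` fixes the edge. -/
structure Signature (A : AdmissibleAction G U L) where
  s : ∀ {v w : U}, w ∈ A.W → A.T.Adj v w → Fiber A.π w → Fiber A.π v
  injective : ∀ {v w : U} (hw : w ∈ A.W) (h : A.T.Adj v w), Function.Injective (s hw h)
  /-- the images for two distinct edges have at most one common point -/
  inter : ∀ {v w v' w' : U} (hw : w ∈ A.W) (h : A.T.Adj v w) (hw' : w' ∈ A.W)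
    (h' : A.T.Adj v' w'), (v, w) ≠ (v', w') →
      (Set.range (fun x => (s hw h x).1) ∩ Set.range (fun x => (s hw' h' x).1)).Subsingleton
  equivariant : ∀ (g : G) {v w : U} (hw : w ∈ A.W) (h : A.T.Adj v w) (x : Fiber A.π w),
    s (A.smul_mem_W g w hw) (A.actsOn g v w h) (x.translate g) = (s hw h x).translate g

namespace Signature

variable {A : AdmissibleAction G U L} (S : Signature A)

/-- The relation `x ≡ s_e(x)` on the disjoint union `L` of the sets `Λ_u`. -/
def Rel (x y : L) : Prop :=
  ∃ (v w : U) (hw : w ∈ A.W) (h : A.T.Adj v w) (z : Fiber A.π w), x = z.1 ∧ y = (S.s hw h z).1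

theorem Rel.smul {S : Signature A} {x y : L} (h : S.Rel x y) (g : G) :
    S.Rel (g • x) (g • y) := by
  obtain ⟨v, w, hw, e, z, rfl, rfl⟩ := h
  exact ⟨g • v, g • w, A.smul_mem_W g w hw, A.actsOn g v w e, z.translate g, rfl,
    by rw [S.equivariant]; rfl⟩

/-- The quotient of `L` by the equivalence relation generated by `x ≡ s_e(x)`. -/
def Points : Type _ := Quot S.Rel

/-- The class of a point of `L`. -/
def cls (x : L) : S.Points := Quot.mk _ x

/-- The quotient is a `G`-set. -/
instance : MulAction G S.Points where
  smul g := Quot.map (fun x => g • x) (fun _ _ h => h.smul g)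
  one_smul p := Quot.inductionOn p fun x => congrArg (Quot.mk _) (one_smul G x)
  mul_smul g h p := Quot.inductionOn p fun x => congrArg (Quot.mk _) (mul_smul g h x)

/-- The image of `Λ_u` in the quotient. -/
def piece (u : U) : Set S.Points := Set.range fun x : Fiber A.π u => S.cls x.1

/-- The parabolic forest, on the disjoint union `L` of the sets `Λ_u`. -/
def forest : SimpleGraph L := SimpleGraph.fromRel S.Rel

theorem forest_adj_smul (g : G) {x y : L} (h : S.forest.Adj x y) :
    S.forest.Adj (g • x) (g • y) := by
  rw [forest, SimpleGraph.fromRel_adj] at h ⊢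
  exact ⟨fun e => h.1 (MulAction.injective g e), h.2.imp (fun r => r.smul g) fun r => r.smul g⟩

/-- Parabolic trees: the components of the parabolic forest. -/
def ParabolicTree : Type _ := S.forest.ConnectedComponent

/-- The parabolic tree that contains a given vertex. -/
def treeOf (x : L) : S.ParabolicTree := S.forest.connectedComponentMk x

/-- `G` acts on the parabolic forest, hence on the set of its components. -/
instance : MulAction G S.ParabolicTree where
  smul g C := SimpleGraph.ConnectedComponent.map
    (⟨fun x => g • x, fun h => S.forest_adj_smul g h⟩ : S.forest →g S.forest) C
  one_smul C := by
    refine SimpleGraph.ConnectedComponent.ind (fun x => ?_) C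
    exact congrArg S.forest.connectedComponentMk (one_smul G x)
  mul_smul g h C := by
    refine SimpleGraph.ConnectedComponent.ind (fun x => ?_) C
    exact congrArg S.forest.connectedComponentMk (mul_smul g h x)

/-- The unordered pair `{a, b}` in `Λ_v` is a neck: it is the image of two distinct points of
`Λ_w` for an edge `(v, w)`. -/
def IsNeck {v : U} (a b : Fiber A.π v) : Prop :=
  ∃ (w : U) (hw : w ∈ A.W) (h : A.T.Adj v w) (x y : Fiber A.π w),
    x ≠ y ∧ a = S.s hw h x ∧ b = S.s hw h y

/-- A `G`-equivariant choice of the vertex graphs `K_u`: for each white vertex `v`, a reservoir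
`K_v`, which is a `(G_v, 𝒫_v)` graph in which the two points of every neck are joined by an edge;
for each red vertex `w`, the complete graph on `Λ_w`, which is a single junction edge if `Λ_w`
has two points. -/
structure VertexGraphs where
  K : ∀ u : U, SimpleGraph (Fiber A.π u)
  isPeripheralGraph : ∀ v ∈ A.V, IsPeripheralGraph (stabilizer G v) (K v)
  neck_adj : ∀ v ∈ A.V, ∀ a b : Fiber A.π v, S.IsNeck a b → (K v).Adj a b
  junction : ∀ w ∈ A.W, K w = ⊤
  equivariant : ∀ (g : G) (u : U) (a b : Fiber A.π u),
    (K u).Adj a b → (K (g • u)).Adj (a.translate g) (b.translate g)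

variable {S} in
/-- The combined graph: two distinct classes are joined by an edge if and only if they have
representatives that are joined by an edge of some `K_u` other than a neck edge. It arises from
the disjoint union of the graphs `K_u` by identifying each `x` in `Λ_w` with all the points
`s_e(x)` (collapsing the pipe edges) and removing the neck edges. -/
def VertexGraphs.combined (R : S.VertexGraphs) : SimpleGraph S.Points where
  Adj p q := p ≠ q ∧ ∃ (u : U) (a b : Fiber A.π u),
    S.cls a.1 = p ∧ S.cls b.1 = q ∧ (R.K u).Adj a b ∧ ¬ S.IsNeck a b
  symm := ⟨fun _ _ ⟨hne, u, a, b, ha, hb, hab, hn⟩ =>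
    ⟨hne.symm, u, b, a, hb, ha, hab.symm, fun ⟨w, hw, h, x, y, hxy, hx, hy⟩ =>
      hn ⟨w, hw, h, y, x, hxy.symm, hy, hx⟩⟩⟩
  loopless := ⟨fun _ h => h.1 rfl⟩

end Signature

end ParabolicCombination

/-!
A `2`-admissible action describes how to glue the vertex graphs `K_v` of the white vertices along
edges, one for each red vertex. The combined graph is the union of convex pieces, indexed by the
tree `T`, in which the piece of a red vertex is a single edge; everything is deduced from this
structure, which is recorded in `TreeDecomposition`.

*The pieces.* The projection of the parabolic forest to `T` is locally injective
(`forest_adj_inj`), so it maps paths to paths. Hence the forest is acyclic, each `Λ_u` maps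
injectively to the quotient, and the vertices `u` whose piece contains a given point form a subtree
(`piece_convex`). Distinct red pieces share at most one point by the condition on signatures
(`piece_red_inter`). Two points of `Λ_v` that are also joined by an edge of another piece form a
neck, so each `K_u` is an induced subgraph (`combined_adj_iff`).

*Convexity.* A path that leaves a white piece does so through a red piece, and it comes back through
the same one. As a red piece is an edge, the excursion can be replaced by this edge, which shortens
the path (`exists_reroute`). So geodesics between points of a piece stay in it, and the pieces are
isometrically embedded.

*Relative hyperbolicity.* For four points, the median in `T` of three of the pieces that contain
them yields either a red piece that separates two of the points from the other two, or a white
piece to which the four points project along red pieces; the four-point condition follows from that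
of the pieces (`TreeDecomposition.hyperbolic`). Fineness is local finiteness of the links of the
vertices in the angle metric (`Fine.angleFine`, `AngleFine.fine`), and a short angle is composed of
short angles in pieces (`TreeDecomposition.angleFine`). The stabilizer of a point of the quotient
acts on a parabolic tree with finite quotient and finitely generated vertex stabilizers, so it is
finitely generated (`fg_of_component`). An element that preserves an edge fixes the vertex of `T`
from which the edge comes, so edge stabilizers are finite.

*Existence of vertex graphs.* Given `(G_v, 𝒫_v)` graphs are extended equivariantly from
representatives of the orbits, and the necks, which form finitely many orbits of edges with finite
stabilizers, are added (`IsPeripheralGraph.sup`). Adding edges of bounded length preserves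
hyperbolicity: a geodesic of the old graph is logarithmically, hence uniformly, close to one of the
new graph (`Hyperbolic.of_le`). Fineness is preserved since the new edges are represented by
translates of finitely many paths, so that each old edge is used only finitely often
(`AngleFine.of_paths`).

*Separation.* A red piece `{p, q}` separates the graph because every vertex of `T` has valence at
least `2`. A geodesic between different sides meets `{p, q}`, and two geodesic rays on different
sides are joined by a geodesic line through `p` or `q`; therefore the two sides, with their points
at infinity, are disjoint open sets that cover the complement of `{p, q}` in `Δ K`
(`IsSide.separatesSpace`).
-/

namespace ParabolicCombination

/-! ### Hyperbolicity of a graph with additional short edges -/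

section Metric

variable {X : Type*}

theorem exists_between {K : SimpleGraph X} (hK : K.Connected) (a b : X) {k : ℕ}
    (hk : k ≤ K.dist a b) : ∃ m, K.dist a m = k ∧ k + K.dist m b = K.dist a b := by
  obtain ⟨p, hp⟩ := hK.exists_walk_length_eq_dist a b
  have h1 : K.dist a (p.getVert k) ≤ k := by
    refine (SimpleGraph.dist_le (p.take k)).trans ?_
    simp
  have h2 : K.dist (p.getVert k) b ≤ p.length - k := by
    refine (SimpleGraph.dist_le (p.drop k)).trans ?_
    simp
  have h3 := hK.dist_triangle (u := a) (v := p.getVert k) (w := b)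
  exact ⟨p.getVert k, by omega, by omega⟩

/-- A geodesic, parametrized by its length; values beyond the length are irrelevant. -/
theorem exists_geodesic_seq {K : SimpleGraph X} (hK : K.Connected) (a b : X) :
    ∃ c : ℕ → X, c 0 = a ∧ c (K.dist a b) = b ∧
      ∀ i j, i ≤ j → j ≤ K.dist a b → K.dist (c i) (c j) = j - i := by
  obtain ⟨p, hp⟩ := hK.exists_walk_length_eq_dist a b
  have key : ∀ i j, i ≤ j → j ≤ K.dist a b → K.dist (p.getVert i) (p.getVert j) ≤ j - i := by
    intro i j hij hj
    have h1 : (p.drop i).getVert (j - i) = p.getVert j := by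
      rw [SimpleGraph.Walk.drop_getVert]; congr 1; omega
    rw [← h1]
    refine (SimpleGraph.dist_le ((p.drop i).take (j - i))).trans ?_
    simp
  refine ⟨p.getVert, p.getVert_zero, by rw [← hp, p.getVert_length], fun i j hij hj => ?_⟩
  have h1 := key i j hij hj
  have h2 := key 0 i (by omega) (by omega)
  have h3 := key j _ hj le_rfl
  rw [← hp, p.getVert_length, hp] at h3
  rw [p.getVert_zero] at h2
  have t1 := hK.dist_triangle (u := a) (v := p.getVert i) (w := b)
  have t2 := hK.dist_triangle (u := p.getVert i) (v := p.getVert j) (w := b)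
  omega

/-- In a `δ`-hyperbolic graph, a point `p` at which the ends of a chain with `n ≤ 2 ^ k` jumps of
size at most `C` have small Gromov product is logarithmically close to the chain. -/
theorem exists_near_of_chain {K : SimpleGraph X} {δ C : ℕ}
    (hδ : ∀ x y z t : X,
      K.dist x y + K.dist z t ≤ max (K.dist x z + K.dist y t) (K.dist x t + K.dist y z) + δ)
    (c : ℕ → X) (p : X) (k : ℕ) : ∀ (i n s : ℕ), n ≤ 2 ^ k →
      (∀ j, i ≤ j → j < i + n → K.dist (c j) (c (j + 1)) ≤ C) →
      K.dist p (c i) + K.dist p (c (i + n)) ≤ K.dist (c i) (c (i + n)) + s →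
      ∃ j, i ≤ j ∧ j ≤ i + n ∧ 2 * K.dist p (c j) ≤ C + s + k * δ := by
  induction k with
  | zero =>
    intro i n s hn hc h
    obtain rfl | rfl : n = 0 ∨ n = 1 := by simp at hn; omega
    · refine ⟨i, le_rfl, by omega, ?_⟩
      simp at h ⊢
      omega
    · have := hc i le_rfl (by omega)
      rcases le_total (K.dist p (c i)) (K.dist p (c (i + 1))) with hle | hle
      · exact ⟨i, le_rfl, by omega, by omega⟩
      · exact ⟨i + 1, by omega, by omega, by omega⟩
  | succ k ih =>
    intro i n s hn hc h
    rw [pow_succ] at hn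
    have h4 := hδ p (c (i + n / 2)) (c i) (c (i + n))
    have e1 : K.dist (c (i + n / 2)) (c i) = K.dist (c i) (c (i + n / 2)) := K.dist_comm
    have hk : (k + 1) * δ = k * δ + δ := by ring
    rcases le_max_iff.1 (Nat.sub_le_iff_le_add.2 h4) with h5 | h5
    · obtain ⟨j, h1, h2, h3⟩ := ih (i + n / 2) (n - n / 2) (s + δ) (by omega)
        (fun j hj hj' => hc j (by omega) (by omega)) (by
          rw [show i + n / 2 + (n - n / 2) = i + n by omega]; omega)
      exact ⟨j, by omega, by omega, by omega⟩
    · obtain ⟨j, h1, h2, h3⟩ := ih i (n / 2) (s + δ) (by omega)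
        (fun j hj hj' => hc j (by omega) (by omega)) (by omega)
      exact ⟨j, by omega, by omega, by omega⟩

/-- A number that is bounded by a linear function of its logarithm is bounded. -/
theorem exists_bound_of_log_bound (a b : ℕ) :
    ∃ D₀ : ℕ, ∀ D : ℕ, (∀ k : ℕ, 6 * D ≤ 2 ^ k → 2 * D ≤ a + k * b) → D ≤ D₀ := by
  obtain ⟨k₀, hk₀⟩ : ∃ k₀, ∀ k, k₀ ≤ k → 6 * (a + k * b) < 2 ^ k := by
    have h1 : Filter.Tendsto (fun k : ℕ => (k : ℝ) ^ 1 / 2 ^ k) Filter.atTop (nhds 0) :=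
      tendsto_pow_const_div_const_pow_of_one_lt 1 (by norm_num)
    have h0 : Filter.Tendsto (fun k : ℕ => (k : ℝ) ^ 0 / 2 ^ k) Filter.atTop (nhds 0) :=
      tendsto_pow_const_div_const_pow_of_one_lt 0 (by norm_num)
    have h2 : Filter.Tendsto (fun k : ℕ => 6 * (a : ℝ) * ((k : ℝ) ^ 0 / 2 ^ k)
        + 6 * b * ((k : ℝ) ^ 1 / 2 ^ k)) Filter.atTop (nhds (6 * (a : ℝ) * 0 + 6 * b * 0)) :=
      (h0.const_mul _).add (h1.const_mul _)
    have h3 := h2.eventually (gt_mem_nhds (show 6 * (a : ℝ) * 0 + 6 * b * 0 < 1 by norm_num))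
    obtain ⟨k₀, hk₀⟩ := Filter.eventually_atTop.1 h3
    refine ⟨k₀, fun k hk => ?_⟩
    have h4 := hk₀ k hk
    have hpos : (0 : ℝ) < 2 ^ k := by positivity
    rw [← mul_div_assoc, ← mul_div_assoc, ← add_div, div_lt_one hpos] at h4
    have : (6 * (a + k * b) : ℝ) < 2 ^ k := by linarith
    exact_mod_cast this
  refine ⟨2 ^ k₀, fun D hD => ?_⟩
  by_contra! hlt
  have hex : ∃ k, 6 * D ≤ 2 ^ k := ⟨6 * D, Nat.lt_two_pow_self.le⟩
  classical
  have hspec := Nat.find_spec hex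
  set k := Nat.find hex with hk
  have hkk : k₀ < k := by
    by_contra! hle
    have := Nat.pow_le_pow_right (n := 2) (by norm_num) hle
    omega
  have hmin := Nat.find_min hex (m := k - 1) (by omega)
  have e : 2 ^ k = 2 ^ (k - 1) * 2 := by rw [← pow_succ]; congr 1; omega
  have h1 := hD k hspec
  have h2 := hk₀ k hkk.le
  omega

/-- Stability of quasi-geodesics: if `K ≤ K'` and edges of `K'` have bounded length in the
hyperbolic graph `K`, then points between `x` and `y` in `K` are almost between them in `K'`. -/
theorem exists_between_bound {K K' : SimpleGraph X} (hK : K.Connected) (hle : K ≤ K') {δ C : ℕ}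
    (hδ : ∀ x y z t : X,
      K.dist x y + K.dist z t ≤ max (K.dist x z + K.dist y t) (K.dist x t + K.dist y z) + δ)
    (hC : ∀ a b, K'.Adj a b → K.dist a b ≤ C) :
    ∃ M : ℕ, ∀ x y p, K.dist x p + K.dist p y = K.dist x y →
      K'.dist x p + K'.dist p y ≤ K'.dist x y + M := by
  have hK' : K'.Connected := hK.mono hle
  have hd : ∀ a b, K'.dist a b ≤ K.dist a b := fun a b =>
    (hK.preconnected a b).dist_anti hle
  obtain ⟨D₀, hD₀⟩ := exists_bound_of_log_bound (C + 2 * δ) δ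
  refine ⟨2 * D₀, fun x y p hp => ?_⟩
  obtain ⟨c, hc0, hcn, hcd⟩ := exists_geodesic_seq hK' x y
  set n := K'.dist x y with hn
  -- the distance from a point to the `K'`-geodesic `c`
  have hex : ∀ p, ∃ j, j ≤ n ∧ ∀ i, i ≤ n → K.dist p (c j) ≤ K.dist p (c i) := by
    intro p
    obtain ⟨j, hj, h⟩ := Finset.exists_min_image (Finset.range (n + 1))
      (fun j => K.dist p (c j)) ⟨0, by simp⟩
    exact ⟨j, by simpa [Nat.lt_succ_iff] using hj,
      fun i hi => h i (by simpa [Nat.lt_succ_iff] using hi)⟩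
  choose f hfn hf using hex
  -- a point of the interval at maximal distance from `c`
  obtain ⟨p₀, hp₀, hmax⟩ : ∃ p₀, K.dist x p₀ + K.dist p₀ y = K.dist x y ∧
      ∀ q, K.dist x q + K.dist q y = K.dist x y → K.dist q (c (f q)) ≤ K.dist p₀ (c (f p₀)) := by
    have hb : BddAbove {k | ∃ q, K.dist x q + K.dist q y = K.dist x y ∧
        K.dist q (c (f q)) = k} := by
      refine ⟨K.dist x y, ?_⟩
      rintro k ⟨q, hq, rfl⟩
      have h1 := hf q 0 (by omega)
      rw [hc0, K.dist_comm (u := q) (v := x)] at h1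
      omega
    have hne : {k | ∃ q, K.dist x q + K.dist q y = K.dist x y ∧
        K.dist q (c (f q)) = k}.Nonempty := ⟨_, p, hp, rfl⟩
    obtain ⟨p₀, h1, h2⟩ := Nat.sSup_mem hne hb
    exact ⟨p₀, h1, fun q hq => by rw [h2]; exact le_csSup hb ⟨q, hq, rfl⟩⟩
  set D := K.dist p₀ (c (f p₀)) with hDdef
  have hdist : ∀ i, i ≤ n → D ≤ K.dist p₀ (c i) := fun i hi => hf p₀ i hi
  suffices hDle : D ≤ D₀ by
    have h1 := hmax p hp
    have h2 := hcd 0 (f p) (by omega) (hfn p)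
    have h3 := hcd (f p) n (hfn p) le_rfl
    rw [hc0] at h2
    rw [hcn] at h3
    have t1 := hK'.dist_triangle (u := x) (v := c (f p)) (w := p)
    have t2 := hK'.dist_triangle (u := p) (v := c (f p)) (w := y)
    have e1 : K'.dist (c (f p)) p = K'.dist p (c (f p)) := K'.dist_comm
    have e2 := hd p (c (f p))
    have := hfn p
    omega
  -- points at distance `2 * D` from `p₀` on both sides
  have side : ∀ z i, i ≤ n → c i = z → (∀ q, K.dist z q + K.dist q p₀ = K.dist z p₀ →
        K.dist x q + K.dist q y = K.dist x y) →
      ∃ u a, K.dist p₀ u + K.dist u z = K.dist p₀ z ∧ K.dist p₀ u ≤ 2 * D ∧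
        a ≤ n ∧ K.dist u (c a) ≤ D ∧
        K.dist u (c a) + 2 * D ≤ K.dist p₀ u + K.dist p₀ (c a) := by
    intro z i hi hz hq
    rcases le_total (K.dist p₀ z) (2 * D) with hle | hle
    · refine ⟨z, i, by simp, hle, hi, by simp [hz], ?_⟩
      have := hdist i hi
      rw [hz] at this ⊢
      simp
      omega
    · obtain ⟨u, h1, h2⟩ := exists_between hK p₀ z hle
      have hu : K.dist x u + K.dist u y = K.dist x y := hq u (by
        rw [K.dist_comm (u := z) (v := u), K.dist_comm (u := u) (v := p₀),
          K.dist_comm (u := z) (v := p₀)]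
        omega)
      have h3 := hmax u hu
      have h4 := hdist (f u) (hfn u)
      exact ⟨u, f u, by omega, by omega, hfn u, h3, by omega⟩
  obtain ⟨u, a, hu1, hu2, han, hu3, hu4⟩ := side x 0 (by omega) hc0 (by
    intro q hq
    have t1 := hK.dist_triangle (u := q) (v := p₀) (w := y)
    have t2 := hK.dist_triangle (u := x) (v := q) (w := y)
    omega)
  obtain ⟨v, b, hv1, hv2, hbn, hv3, hv4⟩ := side y n le_rfl hcn (by
    intro q hq
    have t1 := hK.dist_triangle (u := x) (v := p₀) (w := q)
    have t2 := hK.dist_triangle (u := x) (v := q) (w := y)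
    rw [K.dist_comm (u := y) (v := q), K.dist_comm (u := q) (v := p₀),
      K.dist_comm (u := y) (v := p₀)] at hq
    omega)
  -- `p₀` is between `u` and `v`
  have huv : K.dist p₀ u + K.dist p₀ v = K.dist u v := by
    have t1 := hK.dist_triangle (u := x) (v := u) (w := y)
    have t2 := hK.dist_triangle (u := u) (v := v) (w := y)
    have t3 := hK.dist_triangle (u := u) (v := p₀) (w := v)
    rw [K.dist_comm (u := x) (v := u)] at t1
    rw [K.dist_comm (u := u) (v := p₀)] at t3
    rw [K.dist_comm (u := x) (v := p₀)] at hp₀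
    omega
  -- the Gromov product of `c a` and `c b` at `p₀` is small
  have hgp : 2 * D ≤ 2 * δ ∨
      K.dist p₀ (c a) + K.dist p₀ (c b) ≤ K.dist (c a) (c b) + 2 * δ := by
    have h1 := hδ p₀ (c a) u v
    have h2 := hδ p₀ (c b) (c a) v
    have e1 : K.dist (c a) u = K.dist u (c a) := K.dist_comm
    have e2 : K.dist (c b) (c a) = K.dist (c a) (c b) := K.dist_comm
    have e3 : K.dist (c b) v = K.dist v (c b) := K.dist_comm
    omega
  refine hD₀ D fun k hk => ?_
  rcases hgp with hgp | hgp
  · omega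
  have hab : K.dist (c a) (c b) ≤ 6 * D := by
    have t1 := hK.dist_triangle (u := c a) (v := u) (w := c b)
    have t2 := hK.dist_triangle (u := u) (v := v) (w := c b)
    have e1 : K.dist (c a) u = K.dist u (c a) := K.dist_comm
    omega
  have hadj : ∀ j, j < n → K.dist (c j) (c (j + 1)) ≤ C := fun j hj =>
    hC _ _ (SimpleGraph.dist_eq_one_iff_adj.1 (by rw [hcd j (j + 1) (by omega) (by omega)]; omega))
  rcases le_total a b with hle' | hle'
  · have h1 := hcd a b hle' hbn
    have h2 := hd (c a) (c b)
    obtain ⟨j, hj1, hj2, hj3⟩ := exists_near_of_chain hδ c p₀ k a (b - a) (2 * δ) (by omega)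
      (fun j _ hj => hadj j (by omega)) (by rw [show a + (b - a) = b by omega]; exact hgp)
    have := hdist j (by omega)
    omega
  · have h1 := hcd b a hle' han
    have h2 := hd (c b) (c a)
    have e2 : K.dist (c b) (c a) = K.dist (c a) (c b) := K.dist_comm
    obtain ⟨j, hj1, hj2, hj3⟩ := exists_near_of_chain hδ c p₀ k b (a - b) (2 * δ) (by omega)
      (fun j _ hj => hadj j (by omega)) (by rw [show b + (a - b) = a by omega]; omega)
    have := hdist j (by omega)
    omega

/-- Hyperbolicity is preserved when edges of bounded length are added to a connected graph. -/
theorem Hyperbolic.of_le {K K' : SimpleGraph X} (hK : K.Connected) (hle : K ≤ K')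
    (hyp : Hyperbolic K) {C : ℕ} (hC : ∀ a b, K'.Adj a b → K.dist a b ≤ C) : Hyperbolic K' := by
  have hK' : K'.Connected := hK.mono hle
  have hd : ∀ a b, K'.dist a b ≤ K.dist a b := fun a b =>
    (hK.preconnected a b).dist_anti hle
  obtain ⟨δ, hδ⟩ := hyp
  obtain ⟨M, hM⟩ := exists_between_bound hK hle hδ hC
  -- the same for points that are almost between `u` and `t`
  have hM' : ∀ u t p, K.dist u p + K.dist p t ≤ K.dist u t + (δ + 1) →
      K'.dist u p + K'.dist p t ≤ K'.dist u t + (M + 2 * (2 * δ + 1)) := by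
    intro u t p hp
    obtain ⟨q, hq1, hq2⟩ := exists_between hK u t (k := min (K.dist u p) (K.dist u t)) (by omega)
    have h1 := hδ p q u t
    have h2 := hM u t q (by omega)
    have e1 : K.dist p u = K.dist u p := K.dist_comm
    have e2 : K.dist q u = K.dist u q := K.dist_comm
    have h3 : K.dist p q ≤ 2 * δ + 1 := by
      rcases le_total (K.dist u p) (K.dist u t) with h | h
      · omega
      · have hqt : K.dist q t = 0 := by omega
        have := hK.dist_triangle (u := p) (v := t) (w := q)
        have e3 : K.dist t q = K.dist q t := K.dist_comm
        omega
    have h4 := hd p q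
    have t1 := hK'.dist_triangle (u := u) (v := q) (w := p)
    have t2 := hK'.dist_triangle (u := p) (v := q) (w := t)
    have e3 : K'.dist q p = K'.dist p q := K'.dist_comm
    omega
  refine ⟨3 * (M + 2 * (2 * δ + 1)), fun x y z t => ?_⟩
  -- the point `p` between `x` and `y` at which the triangle with vertex `t` branches
  obtain ⟨p, hp1, hp2⟩ := exists_between hK x y
    (k := (K.dist x y + K.dist x t - K.dist y t) / 2) (by
      have := hK.dist_triangle (u := x) (v := y) (w := t)
      omega)
  have t1 := hK.dist_triangle (u := x) (v := t) (w := y)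
  have t2 := hK.dist_triangle (u := y) (v := x) (w := t)
  have h1 := hδ p t x y
  have h2 := hδ p z x y
  have e1 : K.dist p x = K.dist x p := K.dist_comm
  have e2 : K.dist t y = K.dist y t := K.dist_comm
  have e3 : K.dist t x = K.dist x t := K.dist_comm
  have e4 : K.dist y x = K.dist x y := K.dist_comm
  have e5 : K.dist p y = K.dist y p := K.dist_comm
  have e6 : K.dist z y = K.dist y z := K.dist_comm
  have e7 : K.dist z x = K.dist x z := K.dist_comm
  have hx := hM' x t p (by omega)
  have hy := hM' y t p (by omega)
  have t3 := hK'.dist_triangle (u := z) (v := p) (w := t)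
  have t4 := hK'.dist_triangle (u := x) (v := p) (w := y)
  have f1 : K'.dist p x = K'.dist x p := K'.dist_comm
  have f2 : K'.dist p y = K'.dist y p := K'.dist_comm
  have f3 : K'.dist p z = K'.dist z p := K'.dist_comm
  have hor : K.dist y p + K.dist p z ≤ K.dist y z + (δ + 1) ∨
      K.dist x p + K.dist p z ≤ K.dist x z + (δ + 1) := by omega
  rcases hor with h | h
  · have := hM' y z p h
    omega
  · have := hM' x z p h
    omega

end Metric

/-! ### Fineness in terms of links of vertices -/

section Fineness

variable {X : Type*}

/-- `AngleBall K x y m` is the set of neighbours `z` of `x` that can be reached from `y` by a walk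
of length at most `m` that avoids `x`: a ball in the link of `x` with respect to the angle
metric. -/
def AngleBall (K : SimpleGraph X) (x y : X) (m : ℕ) : Set X :=
  {z | K.Adj x z ∧ ∃ p : K.Walk y z, p.length ≤ m ∧ x ∉ p.support}

/-- Local finiteness of the links of vertices with respect to the angle metric; this is equivalent
to fineness, see `Fine.angleFine` and `AngleFine.fine`. -/
def AngleFine (K : SimpleGraph X) : Prop :=
  ∀ x y, K.Adj x y → ∀ m, (AngleBall K x y m).Finite

theorem Fine.angleFine {K : SimpleGraph X} (hK : Fine K) : AngleFine K := by
  classical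
  intro x y hxy m
  have hfin := (Set.finite_Iic (m + 2)).biUnion fun n _ =>
    (hK s(x, y) (K.mem_edgeSet.2 hxy) n).biUnion fun c _ => c.2.support.finite_toSet
  refine ((Set.finite_singleton y).union hfin).subset ?_
  rintro z ⟨hxz, p, hp, hx⟩
  by_cases hzy : z = y
  · exact Or.inl hzy
  refine Or.inr ?_
  have hx' : x ∉ p.bypass.support := fun h => hx (p.support_bypass_subset_support h)
  have hcyc : (SimpleGraph.Walk.cons hxy (p.bypass.concat hxz.symm)).IsCycle := by
    rw [SimpleGraph.Walk.cons_isCycle_iff]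
    refine ⟨p.bypass_isPath.concat hx' _, ?_⟩
    rw [SimpleGraph.Walk.edges_concat, List.concat_eq_append, List.mem_append, not_or]
    refine ⟨fun h => hx' (SimpleGraph.Walk.fst_mem_support_of_mem_edges _ h), ?_⟩
    simp only [List.mem_singleton, Sym2.eq_iff, not_or, not_and]
    exact ⟨fun h => absurd h hxz.ne, fun _ h => hzy h.symm⟩
  simp only [Set.mem_iUnion]
  refine ⟨_, ?_, ⟨x, _⟩, ⟨hcyc, rfl, by simp⟩, ?_⟩
  · have := p.length_bypass_le_length
    simp
    omega
  · simp [SimpleGraph.Walk.support_concat]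

/-- The vertices of the circuits of bounded length through a given pair of adjacent vertices
`a`, `b`, where the circuit is cut into the walk `q` that starts at `b` and the walk `r` that
ends at `a`. -/
theorem AngleFine.exists_finite {K : SimpleGraph X} (hK : AngleFine K) (N k : ℕ) :
    ∀ a b, K.Adj a b → ∃ B : Set X, B.Finite ∧
      ∀ (x : X) (r : K.Walk x a) (q : K.Walk b x), q.IsPath →
        (∀ v ∈ q.support, v ∈ r.support → v = x) → r.length + q.length ≤ N → q.length ≤ k →
        ∀ v ∈ q.support, v ∈ B := by
  induction k with
  | zero =>
    intro a b _
    refine ⟨{b}, Set.finite_singleton b, fun x r q hq _ _ h v hv => ?_⟩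
    cases q with
    | nil => simpa using hv
    | cons h' q => simp at h
  | succ k ih =>
    intro a b hab
    choose! B hBfin hB using ih b
    refine ⟨{b} ∪ ⋃ z ∈ AngleBall K b a N, B z, (Set.finite_singleton b).union
      ((hK b a hab.symm N).biUnion fun z hz => hBfin z hz.1), fun x r q hq hqr hN hk v hv => ?_⟩
    cases q with
    | nil => exact Or.inl (by simpa using hv)
    | @cons _ z _ hbz q =>
      rw [SimpleGraph.Walk.cons_isPath_iff] at hq
      rw [SimpleGraph.Walk.support_cons, List.mem_cons] at hv
      rcases hv with rfl | hv
      · exact Or.inl rfl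
      have hbx : b ≠ x := fun h => hq.2 (h ▸ q.end_mem_support)
      have hbr : b ∉ r.support := fun h => hbx (hqr b (by simp) h)
      simp only [SimpleGraph.Walk.length_cons] at hN hk
      refine Or.inr (Set.mem_biUnion (x := z) ⟨hbz, (q.append r).reverse, ?_, ?_⟩ ?_)
      · simp; omega
      · simp only [SimpleGraph.Walk.support_reverse, List.mem_reverse,
          SimpleGraph.Walk.mem_support_append_iff, not_or]
        exact ⟨hq.2, hbr⟩
      · refine hB z hbz x (r.concat hab) q hq.1 ?_ (by simp; omega) (by omega) v hv
        intro u hu hu'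
        rw [SimpleGraph.Walk.support_concat, List.mem_append] at hu'
        rcases hu' with hu' | hu'
        · exact hqr u (by simp [hu]) hu'
        · rw [List.mem_singleton] at hu'
          exact absurd (hu' ▸ hu) hq.2

theorem exists_eq_append_cons_of_mem_darts {K : SimpleGraph X} {u v : X} (p : K.Walk u v)
    (d : K.Dart) (hd : d ∈ p.darts) :
    ∃ (p₁ : K.Walk u d.fst) (p₂ : K.Walk d.snd v),
      p = p₁.append (SimpleGraph.Walk.cons d.adj p₂) := by
  induction p with
  | nil => simp at hd
  | @cons a b c h p ih =>
    rw [SimpleGraph.Walk.darts_cons, List.mem_cons] at hd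
    rcases hd with rfl | hd
    · exact ⟨.nil, p, rfl⟩
    · obtain ⟨p₁, p₂, rfl⟩ := ih hd
      exact ⟨.cons h p₁, p₂, rfl⟩

theorem finite_setOf_closedWalk (K : SimpleGraph X) {B : Set X} (hB : B.Finite) (n : ℕ) :
    {c : Σ x : X, K.Walk x x | c.2.length = n ∧ ∀ v ∈ c.2.support, v ∈ B}.Finite := by
  have : Finite B := hB
  have hfin := (List.finite_length_eq B (n + 1)).image (List.map Subtype.val)
  refine Set.Finite.of_finite_image (f := fun c => c.2.support) (hfin.subset ?_) ?_
  · rintro _ ⟨c, ⟨hc, hcB⟩, rfl⟩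
    refine ⟨c.2.support.attach.map fun v => ⟨v.1, hcB v.1 v.2⟩, ?_, ?_⟩
    · simp [hc]
    · simp [List.map_map, Function.comp_def]
  · rintro ⟨x, c⟩ _ ⟨y, d⟩ _ h
    dsimp only at h
    have hxy : x = y := by
      have h1 := c.head_support
      have h2 := d.head_support
      simp only [h] at h1
      exact h1.symm.trans h2
    subst hxy
    rw [SimpleGraph.Walk.ext_support h]

theorem AngleFine.fine {K : SimpleGraph X} (hK : AngleFine K) : Fine K := by
  intro e he n
  induction e with
  | h x y =>
  have hxy : K.Adj x y := he
  obtain ⟨B₁, hB₁, h₁⟩ := hK.exists_finite n n x y hxy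
  obtain ⟨B₂, hB₂, h₂⟩ := hK.exists_finite n n y x hxy.symm
  refine (finite_setOf_closedWalk K (hB₁.union hB₂) n).subset ?_
  rintro ⟨u, c⟩ ⟨hc, hn, hec⟩
  refine ⟨hn, ?_⟩
  dsimp only at hc hn hec ⊢
  -- cut the circuit open at an edge
  have key : ∀ d : K.Dart, d ∈ c.darts → ∃ q : K.Walk d.snd d.fst, q.IsPath ∧ q.length ≤ n ∧
      ∀ v ∈ c.support, v ∈ q.support := by
    intro d hd
    obtain ⟨p₁, p₂, rfl⟩ := exists_eq_append_cons_of_mem_darts c d hd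
    have hsup : (p₁.append (SimpleGraph.Walk.cons d.adj p₂)).support =
        p₁.support ++ p₂.support := by
      rw [SimpleGraph.Walk.support_append]; simp
    refine ⟨p₂.append p₁, ?_, ?_, ?_⟩
    · have hnd := hc.support_nodup
      rw [hsup, List.tail_append_of_ne_nil p₁.support_ne_nil] at hnd
      rw [SimpleGraph.Walk.isPath_def, SimpleGraph.Walk.support_append]
      exact List.nodup_append_comm.1 hnd
    · simp at hn ⊢
      omega
    · intro v hv
      rw [hsup, List.mem_append] at hv
      rw [SimpleGraph.Walk.mem_support_append_iff]
      exact hv.symm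
  have fin : ∀ a b (B : Set X), (∀ (x : X) (r : K.Walk x a) (q : K.Walk b x), q.IsPath →
        (∀ v ∈ q.support, v ∈ r.support → v = x) → r.length + q.length ≤ n → q.length ≤ n →
        ∀ v ∈ q.support, v ∈ B) → ∀ q : K.Walk b a, q.IsPath → q.length ≤ n →
        (∀ v ∈ c.support, v ∈ q.support) → ∀ v ∈ c.support, v ∈ B := by
    intro a b B hB q hq hqn hcq v hv
    exact hB a .nil q hq (fun v _ hv => by simpa using hv) (by simpa using hqn) hqn v (hcq v hv)
  obtain ⟨⟨⟨a, b⟩, hab⟩, hd, hde⟩ := List.mem_map.1 hec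
  obtain ⟨q, hq1, hq2, hq3⟩ := key _ hd
  rcases Sym2.eq_iff.1 hde with ⟨h1, h2⟩ | ⟨h1, h2⟩
  · dsimp only at h1 h2 q
    subst h1 h2
    exact fun v hv => Or.inl (fin _ _ _ h₁ q hq1 hq2 hq3 v hv)
  · dsimp only at h1 h2 q
    subst h1 h2
    exact fun v hv => Or.inr (fin _ _ _ h₂ q hq1 hq2 hq3 v hv)

/-- The vertices that can be reached from a neighbour of `x` in `D` by a walk of length at most `R`
that avoids `x`. -/
def AngleReach (K : SimpleGraph X) (x : X) (D : Set X) (R : ℕ) : Set X :=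
  {v | ∃ d ∈ D, K.Adj x d ∧ ∃ p : K.Walk d v, p.length ≤ R ∧ x ∉ p.support}

theorem AngleReach.mono {K : SimpleGraph X} {x : X} {D D' : Set X} (h : D ⊆ D') {R R' : ℕ}
    (hR : R ≤ R') : AngleReach K x D R ⊆ AngleReach K x D' R' := by
  rintro v ⟨d, hd, hxd, p, hp, hx⟩
  exact ⟨d, h hd, hxd, p, hp.trans hR, hx⟩

theorem exists_first_edge {K : SimpleGraph X} {x y : X} (hxy : x ≠ y) {p : K.Walk x y}
    (hp : p.IsPath) : ∃ d, K.Adj x d ∧ s(x, d) ∈ p.edges ∧ d ∈ p.support ∧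
      ∃ q : K.Walk d y, q.length ≤ p.length ∧ x ∉ q.support := by
  cases p with
  | nil => exact absurd rfl hxy
  | @cons _ d _ h q =>
    rw [SimpleGraph.Walk.cons_isPath_iff] at hp
    exact ⟨d, h, by simp, by simp, q, by simp, hp.2⟩

/-- Fineness passes from `K` to a graph whose edges are represented by paths of bounded length
in `K`, provided each edge of `K` is used finitely often. -/
theorem AngleFine.of_paths {K K' : SimpleGraph X} (hK : AngleFine K) {C : ℕ}
    (P : ∀ a b, K'.Adj a b → K.Walk a b) (hP : ∀ a b h, (P a b h).IsPath)
    (hC : ∀ a b h, (P a b h).length ≤ C)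
    (hfin : ∀ e ∈ K.edgeSet, {ab : X × X | ∃ h, e ∈ (P ab.1 ab.2 h).edges}.Finite) :
    AngleFine K' := by
  classical
  intro x
  -- the vertices on the paths through a given edge at `x`
  set J : X → Set X := fun d => {v | K.Adj x d ∧ ∃ a b h, s(x, d) ∈ (P a b h).edges ∧
    v ∈ (P a b h).support} with hJ
  have hJfin : ∀ d, (J d).Finite := by
    intro d
    by_cases hxd : K.Adj x d
    · refine ((hfin _ (K.mem_edgeSet.2 hxd)).biUnion (t := fun ab =>
        if h : K'.Adj ab.1 ab.2 then {v | v ∈ (P ab.1 ab.2 h).support} else ∅) ?_).subset ?_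
      · intro ab _
        split_ifs with h
        · exact (P ab.1 ab.2 h).support.finite_toSet
        · exact Set.finite_empty
      · rintro v ⟨_, a, b, h, he, hv⟩
        simp only [Set.mem_iUnion]
        exact ⟨(a, b), ⟨h, he⟩, by rw [dif_pos h]; exact hv⟩
    · exact Set.finite_empty.subset fun v hv => hxd hv.1
  have hball : ∀ (D : Set X), D.Finite → ∀ R, (⋃ d ∈ D ∩ {d | K.Adj x d},
      AngleBall K x d R).Finite := fun D hD R =>
    (hD.inter_of_left _).biUnion fun d hd => hK x d hd.2 R
  -- one step of a walk in `K'`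
  have step : ∀ (D : Set X), D.Finite → ∀ R, ∃ D' : Set X, D'.Finite ∧ D ⊆ D' ∧
      ∀ v ∈ AngleReach K x D R, ∀ v', K'.Adj v v' → x ≠ v → x ≠ v' →
        v' ∈ AngleReach K x D' (R + C) := by
    intro D hD R
    refine ⟨D ∪ ⋃ d₁ ∈ ⋃ d ∈ D ∩ {d | K.Adj x d}, AngleBall K x d (R + C), J d₁,
      hD.union ((hball D hD _).biUnion fun d _ => hJfin d), Set.subset_union_left, ?_⟩
    rintro v ⟨d, hd, hxd, p, hpR, hxp⟩ v' hvv' hxv hxv'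
    have hPC := hC v v' hvv'
    by_cases hx : x ∈ (P v v' hvv').support
    · obtain ⟨d₁, h1, h2, -, q₁, h3, h4⟩ := exists_first_edge hxv
        (((hP v v' hvv').takeUntil hx).reverse)
      obtain ⟨d₂, k1, -, k2, q₂, k3, k4⟩ := exists_first_edge hxv' ((hP v v' hvv').dropUntil hx)
      have l1 := (P v v' hvv').length_takeUntil_le_length hx
      have l2 := (P v v' hvv').length_dropUntil_le_length hx
      rw [SimpleGraph.Walk.length_reverse] at h3
      rw [SimpleGraph.Walk.edges_reverse, List.mem_reverse] at h2
      refine ⟨d₂, Or.inr ?_, k1, q₂, by omega, k4⟩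
      simp only [Set.mem_iUnion]
      refine ⟨d₁, ⟨d, ⟨hd, hxd⟩, h1, p.append q₁.reverse, ?_, ?_⟩, h1, v, v', hvv',
        SimpleGraph.Walk.edges_takeUntil_subset_edges _ _ h2,
        SimpleGraph.Walk.support_dropUntil_subset_support _ _ k2⟩
      · simp; omega
      · simp [SimpleGraph.Walk.mem_support_append_iff, hxp, h4]
    · refine ⟨d, Or.inl hd, hxd, p.append (P v v' hvv'), ?_, ?_⟩
      · simp; omega
      · simp [SimpleGraph.Walk.mem_support_append_iff, hxp, hx]
  have steps : ∀ m (D : Set X), D.Finite → ∀ R, ∃ (D' : Set X) (R' : ℕ), D'.Finite ∧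
      ∀ v ∈ AngleReach K x D R, ∀ z (p : K'.Walk v z), p.length ≤ m → x ∉ p.support →
        z ∈ AngleReach K x D' R' := by
    intro m
    induction m with
    | zero =>
      intro D hD R
      refine ⟨D, R, hD, fun v hv z p hp _ => ?_⟩
      cases p with
      | nil => exact hv
      | cons h p => simp at hp
    | succ m ih =>
      intro D hD R
      obtain ⟨D₁, hD₁, hsub, h₁⟩ := step D hD R
      obtain ⟨D', R', hD', h'⟩ := ih D₁ hD₁ (R + C)
      refine ⟨D', R', hD', fun v hv z p hp hx => ?_⟩
      cases p with
      | nil => exact h' v (AngleReach.mono hsub (by omega) hv) v .nil (by simp) (by simpa using hx)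
      | @cons _ v' _ h p =>
        simp only [SimpleGraph.Walk.support_cons, List.mem_cons, not_or] at hx
        refine h' v' (h₁ v hv v' h hx.1 ?_) z p (by simpa using hp) hx.2
        rintro rfl
        exact hx.2 p.start_mem_support
  intro y hxy m
  obtain ⟨d, h1, -, -, q, h3, h4⟩ := exists_first_edge hxy.ne (hP x y hxy)
  obtain ⟨D, R, hD, h⟩ := steps m {d} (Set.finite_singleton d) C
  refine ((hball D hD (R + C)).biUnion fun d _ => hJfin d).subset ?_
  rintro z ⟨hxz, p, hp, hx⟩
  obtain ⟨d', hd', hxd', p', hp', hx'⟩ := h y ⟨d, rfl, h1, q, h3.trans (hC _ _ _), h4⟩ z p hp hx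
  obtain ⟨e, k1, k2, k3, q', k4, k5⟩ := exists_first_edge hxz.ne (hP x z hxz)
  have := hC x z hxz
  simp only [Set.mem_iUnion]
  refine ⟨e, ⟨d', ⟨hd', hxd'⟩, k1, p'.append q'.reverse, ?_, ?_⟩, k1, x, z, hxz, k2,
    SimpleGraph.Walk.end_mem_support _⟩
  · simp; omega
  · simp [SimpleGraph.Walk.mem_support_append_iff, hx', k5]

end Fineness

/-! ### Group actions on graphs -/

section Actions

variable {G X : Type*} [Group G] [MulAction G X]

theorem finite_setOf_smul_eq {a : X} (h : Finite (stabilizer G a)) (b : X) :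
    {g : G | g • a = b}.Finite := by
  by_cases hex : ∃ g₀ : G, g₀ • a = b
  · obtain ⟨g₀, rfl⟩ := hex
    refine ((Set.toFinite (stabilizer G a : Set G)).image (g₀ * ·)).subset fun g hg => ?_
    refine ⟨g₀⁻¹ * g, ?_, by simp⟩
    rw [SetLike.mem_coe, mem_stabilizer_iff, mul_smul, hg, inv_smul_smul]
  · exact Set.finite_empty.subset fun g hg => hex ⟨g, hg⟩

theorem finite_setOf_smul_edge_eq {x y : X} (h : {g : G | s(g • x, g • y) = s(x, y)}.Finite)
    (e : Sym2 X) : {g : G | s(g • x, g • y) = e}.Finite := by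
  by_cases hex : ∃ g₀ : G, s(g₀ • x, g₀ • y) = e
  · obtain ⟨g₀, rfl⟩ := hex
    refine (h.image (g₀ * ·)).subset fun g hg => ?_
    refine ⟨g₀⁻¹ * g, ?_, by simp⟩
    have := congrArg (Sym2.map (g₀⁻¹ • ·)) hg
    simpa [mul_smul] using this
  · exact Set.finite_empty.subset fun g hg => hex ⟨g, hg⟩

/-- Translation by `g` as a graph homomorphism. -/
def ActsOn.hom {K : SimpleGraph X} (h : ActsOn G K) (g : G) : K →g K :=
  ⟨fun x => g • x, fun hxy => h g _ _ hxy⟩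

theorem ActsOn.reachable_smul {K : SimpleGraph X} (h : ActsOn G K) (g : G) {x y : X}
    (hxy : K.Reachable x y) : K.Reachable (g • x) (g • y) :=
  hxy.map (h.hom g)

theorem ActsOn.exists_smul_walk {K : SimpleGraph X} (h : ActsOn G K) (g : G) {x y : X}
    (p : K.Walk x y) : ∃ q : K.Walk (g • x) (g • y), q.length = p.length ∧
      q.edges = p.edges.map (Sym2.map (g • ·)) ∧ (p.IsPath → q.IsPath) :=
  ⟨p.map (h.hom g), SimpleGraph.Walk.length_map _ _, SimpleGraph.Walk.edges_map _ _,
    fun hp => hp.map (MulAction.injective g)⟩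

/-- The stabilizer of a component of a graph is finitely generated if there are finitely many
orbits of edges and the vertex stabilizers are finitely generated. -/
theorem fg_of_component {F : SimpleGraph X} (hF : ActsOn G F) (x₀ : X) (H : Subgroup G)
    (hH : ∀ g, g ∈ H ↔ F.Reachable x₀ (g • x₀)) {E : Set (X × X)} (hE : E.Finite)
    (hEF : ∀ x y, F.Adj x y → ∃ e ∈ E, ∃ g : G, g • e = (x, y))
    (hfg : ∀ x : X, (stabilizer G x).FG) : H.FG := by
  classical
  have hmem : ∀ {g : G} {b b' : X}, F.Reachable x₀ b → F.Reachable x₀ b' → g • b = b' →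
      g ∈ H := by
    intro g b b' hb hb' hg
    subst hg
    exact (hH g).2 (hb'.trans (ActsOn.reachable_smul hF g hb).symm)
  -- representatives of the orbits of edges inside the component
  let P : X × X → G → Prop := fun e g => F.Reachable x₀ (g • e.1) ∧ F.Reachable x₀ (g • e.2)
  let c : X × X → X × X := fun e => if h : ∃ g, P e g then h.choose • e else (x₀, x₀)
  have hc : ∀ e, F.Reachable x₀ (c e).1 ∧ F.Reachable x₀ (c e).2 := by
    intro e
    by_cases h : ∃ g, P e g
    · simp only [c, dif_pos h]
      exact h.choose_spec
    · simp only [c, dif_neg h]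
      exact ⟨.rfl, .rfl⟩
  let B : Set X := {x₀} ∪ ((fun e => (c e).1) '' E ∪ (fun e => (c e).2) '' E)
  have hBfin : B.Finite :=
    (Set.finite_singleton x₀).union ((hE.image _).union (hE.image _))
  have hB : ∀ b ∈ B, F.Reachable x₀ b := by
    rintro b (rfl | ⟨e, _, rfl⟩ | ⟨e, _, rfl⟩)
    exacts [.rfl, (hc e).1, (hc e).2]
  have hedge : ∀ x y, F.Reachable x₀ x → F.Adj x y → ∃ g : G, ∃ a ∈ B, ∃ a' ∈ B,
      g • a = x ∧ g • a' = y := by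
    intro x y hx hxy
    obtain ⟨e, he, g, hg⟩ := hEF x y hxy
    have hex : ∃ g, P e g := by
      refine ⟨g, ?_, ?_⟩
      · rw [show g • e.1 = x from congrArg Prod.fst hg]; exact hx
      · rw [show g • e.2 = y from congrArg Prod.snd hg]; exact hx.trans hxy.reachable
    have hce : c e = hex.choose • e := by simp only [c, dif_pos hex]
    refine ⟨g * hex.choose⁻¹, (c e).1, Or.inr (Or.inl ⟨e, he, rfl⟩), (c e).2,
      Or.inr (Or.inr ⟨e, he, rfl⟩), ?_, ?_⟩
    · rw [hce, mul_smul, Prod.smul_fst, inv_smul_smul]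
      exact congrArg Prod.fst hg
    · rw [hce, mul_smul, Prod.smul_snd, inv_smul_smul]
      exact congrArg Prod.snd hg
  choose S hS using fun x => hfg x
  let t : X × X → G := fun b => if h : ∃ g : G, g • b.1 = b.2 then h.choose else 1
  let Gen : Set G := (⋃ b ∈ B, (S b : Set G)) ∪ t '' (B ×ˢ B)
  have hGfin : Gen.Finite :=
    (hBfin.biUnion fun b _ => (S b).finite_toSet).union ((hBfin.prod hBfin).image t)
  have hgen : ∀ b ∈ B, ∀ b' ∈ B, ∀ g : G, g • b = b' → g ∈ Subgroup.closure Gen := by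
    intro b hb b' hb' g hg
    have hex : ∃ g : G, g • (b, b').1 = (b, b').2 := ⟨g, hg⟩
    have ht : t (b, b') • b = b' := by
      simp only [t, dif_pos hex]
      exact hex.choose_spec
    have h1 : t (b, b') ∈ Subgroup.closure Gen :=
      Subgroup.subset_closure (Or.inr ⟨(b, b'), ⟨hb, hb'⟩, rfl⟩)
    have h2 : (t (b, b'))⁻¹ * g ∈ Subgroup.closure (S b : Set G) := by
      rw [hS b, mem_stabilizer_iff, mul_smul, hg, inv_smul_eq_iff, ht]
    have h3 : Subgroup.closure (S b : Set G) ≤ Subgroup.closure Gen :=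
      Subgroup.closure_mono fun s hs => Or.inl (Set.mem_biUnion hb hs)
    have := mul_mem h1 (h3 h2)
    rwa [mul_inv_cancel_left] at this
  refine (Subgroup.fg_iff H).2 ⟨Gen, le_antisymm ?_ ?_, hGfin⟩
  · rw [Subgroup.closure_le]
    rintro g (hg | ⟨⟨b, b'⟩, ⟨hb, hb'⟩, rfl⟩)
    · simp only [Set.mem_iUnion] at hg
      obtain ⟨b, hb, hg⟩ := hg
      have : g ∈ stabilizer G b := by rw [← hS b]; exact Subgroup.subset_closure hg
      exact hmem (hB b hb) (hB b hb) this
    · by_cases hex : ∃ g : G, g • (b, b').1 = (b, b').2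
      · simp only [t, dif_pos hex]
        exact hmem (hB b hb) (hB b' hb') hex.choose_spec
      · simp only [t, dif_neg hex]
        exact one_mem H
  · have hreach : ∀ x y (p : F.Walk x y), F.Reachable x₀ x →
        (∃ h ∈ Subgroup.closure Gen, ∃ b ∈ B, h • b = x) →
        ∃ h ∈ Subgroup.closure Gen, ∃ b ∈ B, h • b = y := by
      intro x y p
      induction p with
      | nil => exact fun _ h => h
      | @cons x z y hxz p ih =>
        rintro hx ⟨h, hh, b, hb, rfl⟩
        obtain ⟨g, a, ha, a', ha', h1, rfl⟩ := hedge _ _ hx hxz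
        refine ih (hx.trans hxz.reachable) ⟨g, ?_, a', ha', rfl⟩
        have := mul_mem hh (hgen a ha b hb (h⁻¹ * g) (by rw [mul_smul, h1, inv_smul_smul]))
        rwa [mul_inv_cancel_left] at this
    intro g hg
    obtain ⟨p⟩ := (hH g).1 hg
    obtain ⟨h, hh, b, hb, hx⟩ := hreach _ _ p .rfl ⟨1, one_mem _, x₀, Or.inl rfl, one_smul _ _⟩
    have := mul_mem hh (hgen x₀ (Or.inl rfl) b hb (h⁻¹ * g)
      (by rw [mul_smul, ← hx, inv_smul_smul]))
    rwa [mul_inv_cancel_left] at this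

theorem fg_map {G' : Type*} [Group G'] {H : Subgroup G} (hH : H.FG)
    (f : G →* G') : (H.map f).FG := by
  classical
  obtain ⟨S, rfl⟩ := hH
  exact ⟨S.image f, by rw [Finset.coe_image, MonoidHom.map_closure]⟩

theorem AngleFine.of_iso {Y : Type*} {K : SimpleGraph X} {K' : SimpleGraph Y} (e : K ≃g K')
    (hK : AngleFine K) : AngleFine K' := by
  intro x y hxy m
  refine ((hK (e.symm x) (e.symm y) (e.symm.map_adj_iff.2 hxy) m).image e).subset ?_
  rintro z ⟨hxz, p, hp, hx⟩
  refine ⟨e.symm z, ⟨e.symm.map_adj_iff.2 hxz, p.map e.symm.toHom, by simpa using hp, ?_⟩, by simp⟩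
  simpa using hx

theorem dist_map_iso {Y : Type*} {K : SimpleGraph X} {K' : SimpleGraph Y} (hK : K.Connected)
    (e : K ≃g K') (a b : X) : K'.dist (e a) (e b) = K.dist a b := by
  have hK' : K'.Connected := e.connected_iff.1 hK
  apply le_antisymm
  · obtain ⟨p, hp⟩ := hK.exists_walk_length_eq_dist a b
    rw [← hp, ← SimpleGraph.Walk.length_map e.toHom p]
    exact SimpleGraph.dist_le _
  · obtain ⟨p, hp⟩ := hK'.exists_walk_length_eq_dist (e a) (e b)
    have := SimpleGraph.dist_le (p.map e.symm.toHom)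
    simpa [hp] using this

/-- Transport of a `(G, 𝒫)` graph along an isomorphism that is equivariant with respect to an
isomorphism of groups. -/
theorem IsPeripheralGraph.transport {G' Y : Type*} [Group G'] [MulAction G' Y] (φ : G ≃* G')
    {K : SimpleGraph X} {K' : SimpleGraph Y} (e : K ≃g K')
    (he : ∀ (g : G) x, e (g • x) = φ g • e x) (hK : IsPeripheralGraph G K) :
    IsPeripheralGraph G' K' := by
  have he' : ∀ (g : G') y, e.symm (g • y) = φ.symm g • e.symm y := by
    intro g y
    apply e.injective
    rw [he]; simp
  refine ⟨?_, ⟨?_, ?_⟩, e.connected_iff.1 hK.connected, (hK.fine.angleFine.of_iso e).fine, ?_,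
    ?_, ?_⟩
  · intro g x y hxy
    rw [← e.symm.map_adj_iff, he', he']
    exact hK.actsOn _ _ _ (e.symm.map_adj_iff.2 hxy)
  · obtain ⟨R, hR, h⟩ := hK.finiteQuotient.1
    refine ⟨e '' R, hR.image e, fun y => ?_⟩
    obtain ⟨x, hx, g, hg⟩ := h (e.symm y)
    exact ⟨e x, ⟨x, hx, rfl⟩, φ g, by rw [← he, hg]; simp⟩
  · obtain ⟨R, hR, h⟩ := hK.finiteQuotient.2
    refine ⟨Prod.map e e '' R, hR.image _, fun y y' hy => ?_⟩
    obtain ⟨x, hx, g, hg⟩ := h (e.symm y) (e.symm y') (e.symm.map_adj_iff.2 hy)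
    refine ⟨Prod.map e e x, ⟨x, hx, rfl⟩, φ g, ?_⟩
    have h1 : g • x.1 = e.symm y := congrArg Prod.fst hg
    have h2 : g • x.2 = e.symm y' := congrArg Prod.snd hg
    ext
    · simp only [Prod.smul_fst, Prod.map_fst, ← he, h1]; simp
    · simp only [Prod.smul_snd, Prod.map_snd, ← he, h2]; simp
  · obtain ⟨δ, hδ⟩ := hK.hyperbolic
    refine ⟨δ, fun x y z t => ?_⟩
    have := hδ (e.symm x) (e.symm y) (e.symm z) (e.symm t)
    have hd : ∀ a b, K.dist (e.symm a) (e.symm b) = K'.dist a b := fun a b => by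
      rw [← dist_map_iso hK.connected e]; simp
    simpa only [hd] using this
  · intro x y hxy
    refine ((hK.finite_edge_stabilizer _ _ (e.symm.map_adj_iff.2 hxy)).image φ).subset ?_
    intro g hg
    refine ⟨φ.symm g, ?_, by simp⟩
    have := congrArg (Sym2.map e.symm) hg
    simpa [he'] using this
  · intro y
    have : stabilizer G' y = (stabilizer G (e.symm y)).map φ.toMonoidHom := by
      ext g
      rw [Subgroup.mem_map_equiv, mem_stabilizer_iff, mem_stabilizer_iff, ← he']
      exact e.symm.injective.eq_iff.symm
    rw [this]
    exact fg_map (hK.fg_vertex_stabilizer _) _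

/-- Adding finitely many orbits of edges with finite stabilizers to a `(G, 𝒫)` graph gives a
`(G, 𝒫)` graph. -/
theorem IsPeripheralGraph.sup {K N : SimpleGraph X} (hK : IsPeripheralGraph G K)
    (hN : ActsOn G N)
    (hfin : ∃ R : Set (X × X), R.Finite ∧ ∀ x y, N.Adj x y → ∃ e ∈ R, ∃ g : G, g • e = (x, y))
    (hst : ∀ x y, N.Adj x y → {g : G | s(g • x, g • y) = s(x, y)}.Finite) :
    IsPeripheralGraph G (K ⊔ N) := by
  classical
  have hfin' : ∃ R : Set (X × X), R.Finite ∧ ∀ x y, (K ⊔ N).Adj x y →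
      ∃ e ∈ R, ∃ g : G, g • e = (x, y) := by
    obtain ⟨R, hR, h⟩ := hfin
    obtain ⟨R', hR', h'⟩ := hK.finiteQuotient.2
    refine ⟨R ∪ R', hR.union hR', fun x y hxy => ?_⟩
    rcases hxy with hxy | hxy
    · obtain ⟨e, he, hg⟩ := h' x y hxy
      exact ⟨e, Or.inr he, hg⟩
    · obtain ⟨e, he, hg⟩ := h x y hxy
      exact ⟨e, Or.inl he, hg⟩
  obtain ⟨R, hR, hrep⟩ := hfin'
  -- representatives of the edges by paths in `K`
  have hpath := fun e : X × X => hK.connected.exists_path_of_dist e.1 e.2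
  choose Q hQ _ using hpath
  obtain ⟨C, hC⟩ := (hR.image fun e => (Q e).length).bddAbove
  have hP : ∀ a b, (K ⊔ N).Adj a b → ∃ p : K.Walk a b, p.IsPath ∧ p.length ≤ C ∧
      ∀ f ∈ p.edges, ∃ e ∈ R, ∃ g : G, g • e = (a, b) ∧
        ∃ f' ∈ (Q e).edges, Sym2.map (g • ·) f' = f := by
    intro a b h
    obtain ⟨e, he, g, hg⟩ := hrep a b h
    obtain ⟨rfl, rfl⟩ := Prod.mk.inj hg
    obtain ⟨q, hql, hqe, hqp⟩ := hK.actsOn.exists_smul_walk g (Q e)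
    refine ⟨q, hqp (hQ e), ?_, ?_⟩
    · rw [hql]
      exact hC ⟨e, he, rfl⟩
    · intro f hf
      rw [hqe, List.mem_map] at hf
      obtain ⟨f', hf', rfl⟩ := hf
      exact ⟨e, he, g, rfl, f', hf', rfl⟩
  choose P hP hPl hPe using hP
  refine ⟨?_, ⟨hK.finiteQuotient.1, R, hR, hrep⟩,
    hK.connected.mono le_sup_left, ?_, ?_, ?_, hK.fg_vertex_stabilizer⟩
  · rintro g x y (h | h)
    exacts [Or.inl (hK.actsOn g x y h), Or.inr (hN g x y h)]
  · refine (hK.fine.angleFine.of_paths P hP hPl fun e he => ?_).fine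
    refine (hR.biUnion fun e' _ => ((Q e').edges.finite_toSet.biUnion
        (t := fun f => (· • e') '' {k : G | Sym2.map (k • ·) f = e})
      fun f hf => Set.Finite.image _ ?_)).subset ?_
    · have hfK : f ∈ K.edgeSet := SimpleGraph.Walk.edges_subset_edgeSet _ hf
      induction f with
      | h x y =>
      simpa using finite_setOf_smul_edge_eq (hK.finite_edge_stabilizer x y hfK) e
    · rintro ⟨a, b⟩ ⟨h, hab⟩
      obtain ⟨e', he', g, hg, f, hf, hfe⟩ := hPe a b h e hab
      simp only [Set.mem_iUnion]
      exact ⟨e', he', f, hf, g, hfe, hg⟩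
  · refine Hyperbolic.of_le hK.connected le_sup_left hK.hyperbolic (C := C) fun a b h => ?_
    exact (SimpleGraph.dist_le (P a b h)).trans (hPl a b h)
  · rintro x y (h | h)
    exacts [hK.finite_edge_stabilizer x y h, hst x y h]

end Actions

/-! ### Separation in trees -/

section Trees

variable {U : Type*}

/-- The vertex `m` separates `a` from `b` (weakly: `m` may be `a` or `b`). In a tree this means
that `m` lies on the geodesic from `a` to `b`. -/
def Sep (T : SimpleGraph U) (m a b : U) : Prop :=
  ∀ p : T.Walk a b, m ∈ p.support

variable {T : SimpleGraph U} {m a b c : U}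

theorem Sep.symm (h : Sep T m a b) : Sep T m b a := fun p => by
  simpa using h p.reverse

theorem Sep.right (a b : U) : Sep T b a b := fun p => p.end_mem_support

theorem Sep.cotrans (h : Sep T m a c) (b : U) : Sep T m a b ∨ Sep T m b c := by
  by_contra! hcon
  obtain ⟨h1, h2⟩ := hcon
  simp only [Sep, not_forall] at h1 h2
  obtain ⟨p, hp⟩ := h1
  obtain ⟨q, hq⟩ := h2
  have := h (p.append q)
  rw [SimpleGraph.Walk.mem_support_append_iff] at this
  exact this.elim hp hq

/-- If `m` is between `a` and `b` and `m'` is between `m` and `a`, then `m'` is between `a`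
and `b`. -/
theorem Sep.extend {m' : U} (h : Sep T m a b) (h' : Sep T m' m a) : Sep T m' a b := by
  classical
  intro p
  exact SimpleGraph.Walk.support_takeUntil_subset_support _ _ (h'.symm (p.takeUntil m (h p)))

theorem Sep.dist (hT : T.Connected) (h : Sep T m a b) : T.dist a m + T.dist m b = T.dist a b := by
  classical
  obtain ⟨p, hp⟩ := hT.exists_walk_length_eq_dist a b
  have h1 := SimpleGraph.dist_le (p.takeUntil m (h p))
  have h2 := SimpleGraph.dist_le (p.dropUntil m (h p))
  have h3 := congrArg SimpleGraph.Walk.length (p.take_spec (h p))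
  rw [SimpleGraph.Walk.length_append] at h3
  have := hT.dist_triangle (u := a) (v := m) (w := b)
  omega

theorem sep_of_mem_path (hT : T.IsAcyclic) {p : T.Walk a b} (hp : p.IsPath) (h : m ∈ p.support) :
    Sep T m a b := by
  classical
  intro q
  have := congrArg Subtype.val ((hT.subsingleton_path a b).elim ⟨p, hp⟩ q.toPath)
  dsimp only [SimpleGraph.Walk.toPath] at this
  rw [this] at h
  exact q.support_bypass_subset_support h

theorem exists_adj_sep (hT : T.IsTree) (hne : a ≠ b) : ∃ m, T.Adj a m ∧ Sep T m a b := by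
  obtain ⟨p, hp, -⟩ := hT.existsUnique_path a b
  cases p with
  | nil => exact absurd rfl hne
  | @cons _ m _ h q => exact ⟨m, h, sep_of_mem_path hT.isAcyclic hp (by simp)⟩

/-- If `m` does not separate `a` from `b`, then both lie in the same direction from `m`. -/
theorem exists_adj_sep_sep (hT : T.IsTree) (h : ¬ Sep T m a b) :
    ∃ m', T.Adj m m' ∧ Sep T m' m a ∧ Sep T m' m b := by
  classical
  simp only [Sep, not_forall] at h
  obtain ⟨r, hr⟩ := h
  have hma : m ≠ a := fun e => hr (e ▸ r.start_mem_support)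
  obtain ⟨p, hp, -⟩ := hT.existsUnique_path m a
  cases p with
  | nil => exact absurd rfl hma
  | @cons _ m' _ h q =>
    refine ⟨m', h, sep_of_mem_path hT.isAcyclic hp (by simp), ?_⟩
    rw [SimpleGraph.Walk.cons_isPath_iff] at hp
    have hnot : m ∉ (q.append r).bypass.support := fun hm => by
      have := SimpleGraph.Walk.support_bypass_subset_support _ hm
      rw [SimpleGraph.Walk.mem_support_append_iff] at this
      exact this.elim hp.2 hr
    exact sep_of_mem_path hT.isAcyclic ((q.append r).bypass_isPath.cons hnot (h := h)) (by simp)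

/-- Any three vertices of a tree have a median. -/
theorem exists_median (hT : T.IsTree) (a b c : U) :
    ∃ m, Sep T m a b ∧ Sep T m a c ∧ Sep T m b c := by
  obtain ⟨m, hm⟩ := (measure fun m => T.dist m a + T.dist m b + T.dist m c).wf.has_min
    Set.univ ⟨a, trivial⟩
  replace hm := fun m' => hm.2 m' trivial
  -- if two of the points were in the same direction from `m`, a step in this direction would
  -- decrease the sum of the distances
  have key : ∀ m' x, T.Adj m m' → Sep T m' m x → T.dist m' x + 1 = T.dist m x := by
    intro m' x h h'
    have := h'.dist hT.connected
    rw [SimpleGraph.dist_eq_one_iff_adj.2 h] at this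
    omega
  have key' : ∀ m' x, T.Adj m m' → T.dist m' x ≤ T.dist m x + 1 := by
    intro m' x h
    have := hT.connected.dist_triangle (u := m') (v := m) (w := x)
    rw [SimpleGraph.dist_eq_one_iff_adj.2 h.symm] at this
    omega
  refine ⟨m, ?_, ?_, ?_⟩ <;> by_contra hsep <;>
    obtain ⟨m', h, h1, h2⟩ := exists_adj_sep_sep hT hsep <;>
    have e1 := key m' _ h h1 <;> have e2 := key m' _ h h2 <;>
    have e3 := key' m' a h <;> have e4 := key' m' b h <;> have e5 := key' m' c h <;>
    exact hm m' (show T.dist m' a + T.dist m' b + T.dist m' c <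
      T.dist m a + T.dist m b + T.dist m c by omega)

end Trees

/-! ### Graphs decomposed along a tree of pieces that meet in edges -/

/-- A decomposition of the graph `K` along the bipartite tree `T` into pieces, in which the piece
of each vertex in the colour class `W` is a single edge, contained in the adjacent pieces. The
pieces that contain a given vertex of `K` form a subtree of `T`, and two distinct pieces for `W`
share at most one vertex. -/
structure TreeDecomposition {U P : Type*} (T : SimpleGraph U) (W : Set U) (K : SimpleGraph P)
    (piece : U → Set P) : Prop where
  isTree : T.IsTree
  valence : ∀ u, (T.neighborSet u).Nontrivial
  bipartite : ∀ {u u'}, T.Adj u u' → (u ∈ W ↔ u' ∉ W)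
  exists_piece : ∀ p, ∃ u, p ∈ piece u
  convex : ∀ {p u u' m}, p ∈ piece u → p ∈ piece u' → Sep T m u u' → p ∈ piece m
  edge : ∀ {p q}, K.Adj p q → ∃ u, p ∈ piece u ∧ q ∈ piece u
  red_sub : ∀ {v w}, w ∈ W → T.Adj v w → piece w ⊆ piece v
  red_pair : ∀ {w}, w ∈ W → ∃ p q, K.Adj p q ∧ piece w = {p, q}
  red_inter : ∀ {w w'}, w ∈ W → w' ∈ W → w ≠ w' → (piece w ∩ piece w').Subsingleton

namespace TreeDecomposition

variable {U P : Type*} {T : SimpleGraph U} {W : Set U} {K : SimpleGraph P} {piece : U → Set P}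
  (D : TreeDecomposition T W K piece)

include D

theorem red_adj {w : U} (hw : w ∈ W) {p q : P} (hp : p ∈ piece w) (hq : q ∈ piece w)
    (hne : p ≠ q) : K.Adj p q := by
  obtain ⟨a, b, hab, h⟩ := D.red_pair hw
  rw [h] at hp hq
  rcases hp with rfl | rfl <;> rcases hq with rfl | rfl
  exacts [absurd rfl hne, hab, hab.symm, absurd rfl hne]

/-- A walk between points on different sides of `m` meets the piece of `m`. -/
theorem exists_mem_piece {m u u' : U} {p q : P} (c : K.Walk p q) (h : Sep T m u u')
    (hp : p ∈ piece u) (hq : q ∈ piece u') : ∃ r ∈ c.support, r ∈ piece m := by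
  induction c generalizing u with
  | nil => exact ⟨_, by simp, D.convex hp hq h⟩
  | @cons p p₁ q hpp c ih =>
    obtain ⟨u₁, h1, h2⟩ := D.edge hpp
    rcases h.cotrans u₁ with h3 | h3
    · exact ⟨p, by simp, D.convex hp h1 h3⟩
    · obtain ⟨r, hr, hr'⟩ := ih h3 h2 hq
      exact ⟨r, by simp [hr], hr'⟩

/-- A walk between two points of a white piece can be rerouted inside the piece by replacing
excursions through a red piece by an edge; this shortens the walk if it leaves the piece. -/
theorem exists_reroute {v : U} (hv : v ∉ W) (n : ℕ) : ∀ {p q : P} (c : K.Walk p q),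
    c.length ≤ n → p ∈ piece v → q ∈ piece v →
    ∃ c' : K.Walk p q, c'.length ≤ c.length ∧ (∀ r ∈ c'.support, r ∈ c.support) ∧
      (∀ r ∈ c'.support, r ∈ piece v) ∧
      (¬ (∀ r ∈ c.support, r ∈ piece v) → c'.length < c.length) := by
  classical
  induction n with
  | zero =>
    intro p q c hc hp hq
    cases c with
    | nil => exact ⟨.nil, le_rfl, by simp, by simpa using hp, fun h => absurd (by simpa using hp) h⟩
    | cons h c => simp at hc
  | succ n ih =>
    intro p q c hc hp hq
    cases c with
    | nil => exact ⟨.nil, le_rfl, by simp, by simpa using hp, fun h => absurd (by simpa using hp) h⟩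
    | @cons _ p₁ _ h c =>
    simp only [SimpleGraph.Walk.length_cons, add_le_add_iff_right] at hc
    by_cases hp₁ : p₁ ∈ piece v
    · obtain ⟨c', h1, h2, h3, h4⟩ := ih c hc hp₁ hq
      refine ⟨.cons h c', by simpa using h1, ?_, by simpa [hp] using h3, fun hout => ?_⟩
      · simp only [SimpleGraph.Walk.support_cons, List.mem_cons]
        exact fun r hr => hr.imp_right (h2 r)
      · have := h4 fun hin => hout (by simpa [hp] using hin)
        simpa using this
    · obtain ⟨u, hpu, hpu₁⟩ := D.edge h
      have hvu : v ≠ u := fun e => hp₁ (e ▸ hpu₁)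
      obtain ⟨w, hvw, hsep⟩ := exists_adj_sep D.isTree hvu
      have hw : w ∈ W := by
        by_contra hw
        exact hv ((D.bipartite hvw).2 hw)
      have hpw := D.convex hp hpu hsep
      obtain ⟨r, hr, hrw⟩ := D.exists_mem_piece c hsep.symm hpu₁ hq
      have hrv := D.red_sub hw hvw hrw
      have hrp₁ : r ≠ p₁ := fun e => hp₁ (e ▸ hrv)
      have hl := SimpleGraph.Walk.length_dropUntil_lt_length hr hrp₁
      obtain ⟨c', h1, h2, h3, -⟩ := ih (c.dropUntil r hr) (by omega) hrv hq
      have h2' : ∀ s ∈ c'.support, s ∈ c.support := fun s hs =>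
        SimpleGraph.Walk.support_dropUntil_subset_support _ _ (h2 s hs)
      by_cases hrp : r = p
      · subst hrp
        refine ⟨c', ?_, fun s hs => ?_, h3, fun _ => ?_⟩
        · simp; omega
        · simp [h2' s hs]
        · simp; omega
      · refine ⟨.cons (D.red_adj hw hpw hrw (Ne.symm hrp)) c', ?_, ?_, by simpa [hp] using h3,
          fun _ => ?_⟩
        · simp; omega
        · simp only [SimpleGraph.Walk.support_cons, List.mem_cons]
          exact fun s hs => hs.imp_right (h2' s)
        · simp; omega

/-- Geodesics between two points of a piece stay in the piece. -/
theorem mem_piece_of_geodesic {u : U} {p q : P} (hp : p ∈ piece u) (hq : q ∈ piece u)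
    (c : K.Walk p q) (hc : c.length = K.dist p q) : ∀ r ∈ c.support, r ∈ piece u := by
  by_cases hu : u ∈ W
  · by_cases hpq : p = q
    · subst hpq
      rw [SimpleGraph.dist_self] at hc
      cases c with
      | nil => simpa using hp
      | cons h c => simp at hc
    · have hadj := D.red_adj hu hp hq hpq
      rw [SimpleGraph.dist_eq_one_iff_adj.2 hadj] at hc
      cases c with
      | nil => simp at hc
      | cons h c =>
        cases c with
        | nil => simp [hp, hq]
        | cons h' c => simp at hc
  · by_contra hout
    obtain ⟨c', -, -, -, h⟩ := D.exists_reroute hu _ c le_rfl hp hq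
    have := h hout
    have := SimpleGraph.dist_le c'
    omega

/-- Two distinct points lie in finitely many common pieces: in at most one white piece, or in a
single red piece and some of its neighbours. -/
theorem finite_pieces (hloc : ∀ w ∈ W, (T.neighborSet w).Finite) {p q : P} (hpq : p ≠ q) :
    {u | p ∈ piece u ∧ q ∈ piece u}.Finite := by
  have step : ∀ {u u'}, u ≠ u' → p ∈ piece u → q ∈ piece u → p ∈ piece u' → q ∈ piece u' →
      ∃ m, T.Adj u m ∧ p ∈ piece m ∧ q ∈ piece m := by
    intro u u' hne h1 h2 h3 h4
    obtain ⟨m, hm, hsep⟩ := exists_adj_sep D.isTree hne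
    exact ⟨m, hm, D.convex h1 h3 hsep, D.convex h2 h4 hsep⟩
  have red_unique : ∀ {w w'}, w ∈ W → w' ∈ W → p ∈ piece w → q ∈ piece w → p ∈ piece w' →
      q ∈ piece w' → w = w' := by
    intro w w' hw hw' h1 h2 h3 h4
    by_contra hne
    exact hpq (D.red_inter hw hw' hne ⟨h1, h3⟩ ⟨h2, h4⟩)
  by_cases hex : ∃ w ∈ W, p ∈ piece w ∧ q ∈ piece w
  · obtain ⟨w, hw, hpw, hqw⟩ := hex
    refine ((Set.finite_singleton w).union (hloc w hw)).subset fun u ⟨hpu, hqu⟩ => ?_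
    by_cases huw : u = w
    · exact Or.inl huw
    refine Or.inr ?_
    have hu : u ∉ W := fun hu => huw (red_unique hu hw hpu hqu hpw hqw)
    obtain ⟨m, hm, hpm, hqm⟩ := step huw hpu hqu hpw hqw
    have hmW : m ∈ W := by
      by_contra hm'
      exact hu ((D.bipartite hm).2 hm')
    rw [← red_unique hmW hw hpm hqm hpw hqw]
    exact hm.symm
  · push Not at hex
    refine Set.Subsingleton.finite fun u ⟨h1, h2⟩ u' ⟨h3, h4⟩ => ?_
    by_contra hne
    obtain ⟨m, hm, hpm, hqm⟩ := step hne h1 h2 h3 h4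
    by_cases hu : u ∈ W
    · exact hex u hu h1 h2
    · refine hex m ?_ hpm hqm
      by_contra hm'
      exact hu ((D.bipartite hm).2 hm')

/-- If the pieces are fine, so is the graph. An angle at `x` between neighbours in a common piece is
realized in that piece; otherwise the edge of a red piece at `x` cuts the angle into two smaller
ones. -/
theorem angleFine (hloc : ∀ w ∈ W, (T.neighborSet w).Finite)
    (hfine : ∀ v ∉ W, ∀ x ∈ piece v, ∀ y ∈ piece v, K.Adj x y → ∀ m : ℕ,
      {z | K.Adj x z ∧ ∃ c : K.Walk y z, c.length ≤ m ∧ x ∉ c.support ∧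
        ∀ r ∈ c.support, r ∈ piece v}.Finite) : AngleFine K := by
  classical
  intro x y hxy m
  induction m generalizing y with
  | zero =>
    refine (Set.finite_singleton y).subset ?_
    rintro z ⟨-, c, hc, -⟩
    cases c with
    | nil => rfl
    | cons h c => simp at hc
  | succ m ih =>
    have hfin := (D.finite_pieces hloc hxy.ne).inter_of_left Wᶜ
    refine ((hfin.biUnion fun v hv => hfine v hv.2 x hv.1.1 y hv.1.2 hxy (m + 1)).union
      ((ih y hxy).biUnion fun y' hy' => ih y' hy'.1)).subset ?_
    rintro z ⟨hxz, c, hc, hxc⟩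
    by_cases hcommon : ∃ u, x ∈ piece u ∧ y ∈ piece u ∧ z ∈ piece u
    · obtain ⟨u, hxu, hyu, hzu⟩ := hcommon
      obtain ⟨v, hv, hxv, hyv, hzv⟩ : ∃ v, v ∉ W ∧ x ∈ piece v ∧ y ∈ piece v ∧ z ∈ piece v := by
        by_cases hu : u ∈ W
        · obtain ⟨v, huv⟩ := (D.valence u).nonempty
          have hs := D.red_sub hu huv.symm
          exact ⟨v, (D.bipartite huv).1 hu, hs hxu, hs hyu, hs hzu⟩
        · exact ⟨u, hu, hxu, hyu, hzu⟩
      obtain ⟨c', h1, h2, h3, -⟩ := D.exists_reroute hv _ c le_rfl hyv hzv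
      exact Or.inl (Set.mem_biUnion (x := v) ⟨⟨hxv, hyv⟩, hv⟩
        ⟨hxz, c', h1.trans hc, fun h => hxc (h2 x h), h3⟩)
    · refine Or.inr ?_
      -- pieces `u` of `x`, `y` and `u'` of `x`, `z` at minimal distance
      obtain ⟨⟨u, u'⟩, ⟨hxu, hyu, hxu', hzu'⟩, hmin⟩ :=
        (measure fun u : U × U => T.dist u.1 u.2).wf.has_min
          {u | x ∈ piece u.1 ∧ y ∈ piece u.1 ∧ x ∈ piece u.2 ∧ z ∈ piece u.2} (by
            obtain ⟨u, h1, h2⟩ := D.edge hxy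
            obtain ⟨u', h3, h4⟩ := D.edge hxz
            exact ⟨(u, u'), h1, h2, h3, h4⟩)
      dsimp only at hxu hyu hxu' hzu'
      have hne : u ≠ u' := fun e => hcommon ⟨u, hxu, hyu, e ▸ hzu'⟩
      obtain ⟨w, huw, hsep⟩ := exists_adj_sep D.isTree hne
      have hxw := D.convex hxu hxu' hsep
      have hyw : y ∉ piece w := fun hyw => by
        refine hmin (w, u') ⟨hxw, hyw, hxu', hzu'⟩ (show T.dist w u' < T.dist u u' from ?_)
        have := hsep.dist D.isTree.connected
        rw [SimpleGraph.dist_eq_one_iff_adj.2 huw] at this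
        omega
      have hw : w ∈ W := by
        by_contra hw
        exact hyw (D.red_sub ((D.bipartite huw).2 hw) huw.symm hyu)
      have hzw : z ∉ piece w := fun hzw => hcommon ⟨u, hxu, hyu, D.red_sub hw huw hzw⟩
      obtain ⟨r, hr, hrw⟩ := D.exists_mem_piece c hsep hyu hzu'
      have hrx : x ≠ r := fun e => hxc (e ▸ hr)
      have hry : r ≠ y := fun e => hyw (e ▸ hrw)
      have hrz : r ≠ z := fun e => hzw (e ▸ hrw)
      have hxr := D.red_adj hw hxw hrw hrx
      have l1 := SimpleGraph.Walk.length_takeUntil_lt_length hr hrz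
      have l2 := SimpleGraph.Walk.length_dropUntil_lt_length hr hry
      exact Set.mem_biUnion (x := r)
        ⟨hxr, c.takeUntil r hr, by omega,
          fun h => hxc (SimpleGraph.Walk.support_takeUntil_subset_support _ _ h)⟩
        ⟨hxz, c.dropUntil r hr, by omega,
          fun h => hxc (SimpleGraph.Walk.support_dropUntil_subset_support _ _ h)⟩

/-- A red piece between two points is at distance at most `1` from their geodesics. -/
theorem dist_add_dist_le (hK : K.Connected) {w u u' : U} (hw : w ∈ W) (h : Sep T w u u')
    {p q a : P} (hp : p ∈ piece u) (hq : q ∈ piece u') (ha : a ∈ piece w) :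
    K.dist p a + K.dist a q ≤ K.dist p q + 2 := by
  classical
  obtain ⟨c, hc⟩ := hK.exists_walk_length_eq_dist p q
  obtain ⟨r, hr, hrw⟩ := D.exists_mem_piece c h hp hq
  have h1 := SimpleGraph.dist_le (c.takeUntil r hr)
  have h2 := SimpleGraph.dist_le (c.dropUntil r hr)
  have h3 := congrArg SimpleGraph.Walk.length (c.take_spec hr)
  rw [SimpleGraph.Walk.length_append] at h3
  have h4 : K.dist r a ≤ 1 := by
    by_cases hra : r = a
    · simp [hra]
    · exact (SimpleGraph.dist_eq_one_iff_adj.2 (D.red_adj hw hrw ha hra)).le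
  have t1 := hK.dist_triangle (u := p) (v := r) (w := a)
  have t2 := hK.dist_triangle (u := a) (v := r) (w := q)
  have e : K.dist a r = K.dist r a := K.dist_comm
  omega

/-- The projection of a point to a white piece. -/
theorem exists_projection (hK : K.Connected) {m u : U} (hm : m ∉ W) {p : P} (hp : p ∈ piece u) :
    ∃ p' ∈ piece m, ∀ u₂, ∀ q ∈ piece u₂, Sep T m u u₂ →
      K.dist p p' + K.dist p' q ≤ K.dist p q + 2 := by
  by_cases hmu : m = u
  · subst hmu
    exact ⟨p, hp, fun _ _ _ _ => by simp⟩
  · obtain ⟨w, hmw, hsep⟩ := exists_adj_sep D.isTree hmu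
    have hw : w ∈ W := by
      by_contra hw
      exact hm ((D.bipartite hmw).2 hw)
    obtain ⟨a, b, -, hab⟩ := D.red_pair hw
    have ha : a ∈ piece w := by simp [hab]
    exact ⟨a, D.red_sub hw hmw ha, fun u₂ q hq h =>
      D.dist_add_dist_le hK hw (h.extend hsep) hp hq ha⟩

/-- If the pieces are uniformly hyperbolic, the graph is hyperbolic. Four points either project to
four points of a common white piece, or they are separated into two pairs by a red piece; then the
two larger of the three sums of distances agree up to a constant. -/
theorem hyperbolic (hK : K.Connected) {δ : ℕ}
    (hδ : ∀ v ∉ W, ∀ x ∈ piece v, ∀ y ∈ piece v, ∀ z ∈ piece v, ∀ t ∈ piece v,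
      K.dist x y + K.dist z t ≤ max (K.dist x z + K.dist y t) (K.dist x t + K.dist y z) + δ) :
    Hyperbolic K := by
  refine ⟨δ + 8, fun x y z t => ?_⟩
  obtain ⟨ux, hx⟩ := D.exists_piece x
  obtain ⟨uy, hy⟩ := D.exists_piece y
  obtain ⟨uz, hz⟩ := D.exists_piece z
  obtain ⟨ut, ht⟩ := D.exists_piece t
  obtain ⟨m, hxy, hxz, hyz⟩ := exists_median D.isTree ux uy uz
  have c1 : K.dist z y = K.dist y z := K.dist_comm
  have c2 : K.dist t y = K.dist y t := K.dist_comm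
  have c3 : K.dist t z = K.dist z t := K.dist_comm
  have c4 : K.dist t x = K.dist x t := K.dist_comm
  have c5 : K.dist z x = K.dist x z := K.dist_comm
  have c6 : K.dist y x = K.dist x y := K.dist_comm
  -- if two of the points are on the same side of `m`, a red piece separates them from the others
  have split : ∀ {a b c d : P} {ua ub uc ud : U}, a ∈ piece ua → b ∈ piece ub → c ∈ piece uc →
      d ∈ piece ud → Sep T m ua uc → Sep T m ua ud → ¬ Sep T m ua ub →
      ∃ r, K.dist a r + K.dist r c ≤ K.dist a c + 2 ∧ K.dist a r + K.dist r d ≤ K.dist a d + 2 ∧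
        K.dist b r + K.dist r c ≤ K.dist b c + 2 ∧ K.dist b r + K.dist r d ≤ K.dist b d + 2 := by
    intro a b c d ua ub uc ud ha hb hc hd hac had hab
    obtain ⟨m', hmm, h1, h2⟩ := exists_adj_sep_sep D.isTree hab
    have hbc : Sep T m ub uc := (hac.cotrans ub).resolve_left hab
    have hbd : Sep T m ub ud := (had.cotrans ub).resolve_left hab
    obtain ⟨w, hw, k1, k2, k3, k4⟩ : ∃ w ∈ W, Sep T w ua uc ∧ Sep T w ua ud ∧ Sep T w ub uc ∧
        Sep T w ub ud := by
      by_cases hm : m ∈ W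
      · exact ⟨m, hm, hac, had, hbc, hbd⟩
      · refine ⟨m', ?_, hac.extend h1, had.extend h1, hbc.extend h2, hbd.extend h2⟩
        by_contra hm'
        exact hm ((D.bipartite hmm).2 hm')
    obtain ⟨r, _, -, hr⟩ := D.red_pair hw
    have hr : r ∈ piece w := by simp [hr]
    exact ⟨r, D.dist_add_dist_le hK hw k1 ha hc hr, D.dist_add_dist_le hK hw k2 ha hd hr,
      D.dist_add_dist_le hK hw k3 hb hc hr, D.dist_add_dist_le hK hw k4 hb hd hr⟩
  by_cases hxt : Sep T m ux ut
  · by_cases hyt : Sep T m uy ut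
    · by_cases hzt : Sep T m uz ut
      · by_cases hm : m ∈ W
        · obtain ⟨r, _, -, hr⟩ := D.red_pair hm
          have hr : r ∈ piece m := by simp [hr]
          have h1 := D.dist_add_dist_le hK hm hxz hx hz hr
          have h2 := D.dist_add_dist_le hK hm hyt hy ht hr
          have t1 := hK.dist_triangle (u := x) (v := r) (w := y)
          have t2 := hK.dist_triangle (u := z) (v := r) (w := t)
          have e1 : K.dist z r = K.dist r z := K.dist_comm
          have e2 : K.dist y r = K.dist r y := K.dist_comm
          omega
        · -- all four points are in different directions from the white vertex `m`
          obtain ⟨x', hx', kx⟩ := D.exists_projection hK hm hx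
          obtain ⟨y', hy', ky⟩ := D.exists_projection hK hm hy
          obtain ⟨z', hz', kz⟩ := D.exists_projection hK hm hz
          obtain ⟨t', ht', kt⟩ := D.exists_projection hK hm ht
          have h4 := hδ m hm x' hx' y' hy' z' hz' t' ht'
          have a1 := kx _ z hz hxz
          have a2 := kz _ x' hx' (Sep.right uz m)
          have b1 := kx _ t ht hxt
          have b2 := kt _ x' hx' (Sep.right ut m)
          have d1 := ky _ t ht hyt
          have d2 := kt _ y' hy' (Sep.right ut m)
          have f1 := ky _ z hz hyz
          have f2 := kz _ y' hy' (Sep.right uz m)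
          have t1 := hK.dist_triangle (u := x) (v := x') (w := y)
          have t2 := hK.dist_triangle (u := x') (v := y') (w := y)
          have t3 := hK.dist_triangle (u := z) (v := z') (w := t)
          have t4 := hK.dist_triangle (u := z') (v := t') (w := t)
          have e1 : K.dist z x' = K.dist x' z := K.dist_comm
          have e2 : K.dist z' x' = K.dist x' z' := K.dist_comm
          have e3 : K.dist t x' = K.dist x' t := K.dist_comm
          have e4 : K.dist t' x' = K.dist x' t' := K.dist_comm
          have e5 : K.dist t y' = K.dist y' t := K.dist_comm
          have e6 : K.dist t' y' = K.dist y' t' := K.dist_comm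
          have e7 : K.dist z y' = K.dist y' z := K.dist_comm
          have e8 : K.dist z' y' = K.dist y' z' := K.dist_comm
          have e9 : K.dist y' y = K.dist y y' := K.dist_comm
          have e10 : K.dist t' t = K.dist t t' := K.dist_comm
          omega
      · obtain ⟨r, h1, h2, h3, h4⟩ := split hz ht hx hy hxz.symm hyz.symm hzt
        have t1 := hK.dist_triangle (u := x) (v := r) (w := y)
        have t2 := hK.dist_triangle (u := z) (v := r) (w := t)
        have e1 : K.dist x r = K.dist r x := K.dist_comm
        have e2 : K.dist t r = K.dist r t := K.dist_comm
        omega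
    · obtain ⟨r, h1, h2, h3, h4⟩ := split hy ht hx hz hxy.symm hyz hyt
      have t1 := hK.dist_triangle (u := y) (v := r) (w := t)
      have t2 := hK.dist_triangle (u := x) (v := r) (w := y)
      have t3 := hK.dist_triangle (u := z) (v := r) (w := t)
      have e1 : K.dist x r = K.dist r x := K.dist_comm
      have e2 : K.dist t r = K.dist r t := K.dist_comm
      have e3 : K.dist y r = K.dist r y := K.dist_comm
      have e4 : K.dist z r = K.dist r z := K.dist_comm
      omega
  · obtain ⟨r, h1, h2, h3, h4⟩ := split hx ht hy hz hxy hxz hxt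
    have t2 := hK.dist_triangle (u := x) (v := r) (w := y)
    have t3 := hK.dist_triangle (u := z) (v := r) (w := t)
    have e2 : K.dist t r = K.dist r t := K.dist_comm
    have e4 : K.dist z r = K.dist r z := K.dist_comm
    omega

end TreeDecomposition

/-! ### Geodesic rays and lines -/

section Rays

variable {X : Type*} {K : SimpleGraph X}

/-- Along a geodesic ray, the distance from a fixed vertex eventually grows with slope `1`: it
minus the parameter is a nonincreasing function that is bounded below. -/
theorem exists_dist_stable (hK : K.Connected) (q : X) (r : GeodesicRay K) :
    ∃ N, ∀ M, N ≤ M → ∀ n, K.dist q (r.1 (M + n)) = K.dist q (r.1 M) + n := by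
  have hstep : ∀ M n, K.dist q (r.1 (M + n)) ≤ K.dist q (r.1 M) + n := by
    intro M n
    have h1 := r.2 M (M + n) (by omega)
    have := hK.dist_triangle (u := q) (v := r.1 M) (w := r.1 (M + n))
    omega
  have hlow : ∀ n, n ≤ K.dist q (r.1 n) + K.dist q (r.1 0) := by
    intro n
    have h1 := r.2 0 n (by omega)
    have := hK.dist_triangle (u := r.1 0) (v := q) (w := r.1 n)
    have e : K.dist (r.1 0) q = K.dist q (r.1 0) := K.dist_comm
    omega
  obtain ⟨N, hN⟩ := (measure fun n => K.dist q (r.1 n) + K.dist q (r.1 0) - n).wf.has_min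
    Set.univ ⟨0, trivial⟩
  refine ⟨N, fun M hM n => ?_⟩
  have h1 : ¬ K.dist q (r.1 (M + n)) + K.dist q (r.1 0) - (M + n) <
    K.dist q (r.1 N) + K.dist q (r.1 0) - N := hN.2 (M + n) trivial
  have h2 := hstep M n
  have h3 := hstep N (M - N)
  rw [show N + (M - N) = M by omega] at h3
  have := hlow N
  have := hlow M
  have := hlow (M + n)
  omega

/-- A geodesic from `q` to a point of a ray, followed by the rest of the ray. -/
theorem exists_ray_of_stable (hK : K.Connected) {q : X} {r : GeodesicRay K} {N : ℕ}
    (hN : ∀ n, K.dist q (r.1 (N + n)) = K.dist q (r.1 N) + n) :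
    ∃ s : GeodesicRay K, s.1 0 = q ∧ (∀ n, s.1 (K.dist q (r.1 N) + n) = r.1 (N + n)) ∧
      (Quotient.mk (asymptotic K) s) = Quotient.mk (asymptotic K) r := by
  obtain ⟨c, hc0, hcn, hcd⟩ := exists_geodesic_seq hK q (r.1 N)
  set f := K.dist q (r.1 N) with hf
  let s : ℕ → X := fun i => if i ≤ f then c i else r.1 (N + (i - f))
  have hs1 : ∀ i, i ≤ f → s i = c i := fun i hi => if_pos hi
  have hs2 : ∀ n, s (f + n) = r.1 (N + n) := by
    intro n
    by_cases hn : n = 0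
    · subst hn
      rw [add_zero, hs1 f le_rfl, hcn, add_zero]
    · simp only [s]
      rw [if_neg (by omega), Nat.add_sub_cancel_left]
  have hs0 : s 0 = q := (hs1 0 (by omega)).trans hc0
  have hq : ∀ j, K.dist q (s j) = j := by
    intro j
    rcases le_total j f with hj | hj
    · rw [hs1 j hj, ← hc0, hcd 0 j (by omega) hj]
      omega
    · obtain ⟨n, rfl⟩ := Nat.exists_eq_add_of_le hj
      rw [hs2, hN]
  have hup : ∀ i j, i ≤ j → K.dist (s i) (s j) ≤ j - i := by
    intro i j hij
    rcases le_total j f with hj | hj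
    · rw [hs1 i (by omega), hs1 j hj, hcd i j hij hj]
    · obtain ⟨m, rfl⟩ := Nat.exists_eq_add_of_le hj
      rcases le_total i f with hi | hi
      · have h1 := hcd i f hi le_rfl
        have h2 := r.2 N (N + m) (by omega)
        have h3 := hK.dist_triangle (u := s i) (v := r.1 N) (w := s (f + m))
        rw [hs1 i hi, hs2] at h3 ⊢
        rw [hcn] at h1
        omega
      · obtain ⟨n, rfl⟩ := Nat.exists_eq_add_of_le hi
        rw [hs2, hs2, r.2 _ _ (by omega)]
        omega
  have hgeo : ∀ i j, i ≤ j → K.dist (s i) (s j) = j - i := by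
    intro i j hij
    have h1 := hup i j hij
    have h2 := hK.dist_triangle (u := q) (v := s i) (w := s j)
    rw [hq, hq] at h2
    omega
  refine ⟨⟨s, hgeo⟩, hs0, hs2, Quotient.sound ⟨2 * f + N + K.dist q (r.1 0), fun n => ?_⟩⟩
  show K.edist (s n) (r.1 n) ≤ _
  rw [← (hK.preconnected (s n) (r.1 n)).coe_dist_eq_edist]
  suffices h : K.dist (s n) (r.1 n) ≤ 2 * f + N + K.dist q (r.1 0) by exact_mod_cast h
  rcases le_total f n with hn | hn
  · obtain ⟨m, rfl⟩ := Nat.exists_eq_add_of_le hn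
    rw [hs2]
    rcases le_total (N + m) (f + m) with h | h
    · rw [r.2 _ _ h]; omega
    · rw [SimpleGraph.dist_comm, r.2 _ _ h]; omega
  · have h1 := hK.dist_triangle (u := s n) (v := q) (w := r.1 n)
    have h2 := hK.dist_triangle (u := q) (v := r.1 0) (w := r.1 n)
    have h3 := r.2 0 n (by omega)
    rw [SimpleGraph.dist_comm (u := s n) (v := q), hq] at h1
    omega

/-- Every point at infinity is the end of a geodesic ray from any given vertex. -/
theorem exists_ray_from (hK : K.Connected) (q : X) (r : GeodesicRay K) :
    ∃ s : GeodesicRay K, s.1 0 = q ∧ (∃ i j, ∀ n, s.1 (i + n) = r.1 (j + n)) ∧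
      (Quotient.mk (asymptotic K) s) = Quotient.mk (asymptotic K) r := by
  obtain ⟨N, hN⟩ := exists_dist_stable hK q r
  obtain ⟨s, h0, h1, h2⟩ := exists_ray_of_stable hK (hN N le_rfl)
  exact ⟨s, h0, ⟨_, _, h1⟩, h2⟩

/-- Two rays from a common vertex form a geodesic line if their tails are as far apart as
possible. -/
theorem exists_line_of_rays (hK : K.Connected) {s₁ s₂ : GeodesicRay K} (h0 : s₁.1 0 = s₂.1 0)
    {f₁ f₂ : ℕ} (h : ∀ n m, (f₁ + n) + (f₂ + m) ≤ K.dist (s₁.1 (f₁ + n)) (s₂.1 (f₂ + m))) :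
    ∃ l : GeodesicLine K, l.1 0 = s₁.1 0 ∧ l.neg = s₁ ∧ l.pos = s₂ := by
  have hd : ∀ n m, K.dist (s₁.1 n) (s₂.1 m) = n + m := by
    intro n m
    have h1 := h n m
    have k1 := s₁.2 n (f₁ + n) (by omega)
    have k2 := s₂.2 m (f₂ + m) (by omega)
    have k3 := s₁.2 0 n (by omega)
    have k4 := s₂.2 0 m (by omega)
    have t1 := hK.dist_triangle (u := s₁.1 (f₁ + n)) (v := s₁.1 n) (w := s₂.1 (f₂ + m))
    have t2 := hK.dist_triangle (u := s₁.1 n) (v := s₂.1 m) (w := s₂.1 (f₂ + m))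
    have t3 := hK.dist_triangle (u := s₁.1 n) (v := s₁.1 0) (w := s₂.1 m)
    rw [h0] at t3 k3
    rw [SimpleGraph.dist_comm (u := s₁.1 (f₁ + n)) (v := s₁.1 n)] at t1
    rw [SimpleGraph.dist_comm (u := s₁.1 n) (v := s₂.1 0)] at t3
    omega
  let l : ℤ → X := fun i => if 0 ≤ i then s₂.1 i.toNat else s₁.1 (-i).toNat
  have hl : ∀ i j, i ≤ j → (K.dist (l i) (l j) : ℤ) = j - i := by
    intro i j hij
    simp only [l]
    split_ifs with h1 h2 h2
    · rw [s₂.2 _ _ (by omega)]; omega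
    · omega
    · rw [hd]; omega
    · rw [SimpleGraph.dist_comm, s₁.2 _ _ (by omega)]; omega
  refine ⟨⟨l, hl⟩, by simp [l, h0], ?_, ?_⟩
  · refine Subtype.ext (funext fun n => ?_)
    show l (-n) = s₁.1 n
    rcases Nat.eq_zero_or_pos n with rfl | hn
    · simp [l, h0]
    · simp only [l]
      rw [if_neg (by omega), neg_neg, Int.toNat_natCast]
  · refine Subtype.ext (funext fun n => ?_)
    show l n = s₂.1 n
    simp [l]

end Rays

/-! ### Separation of a graph and of its boundary by an edge -/

section EdgeSeparation

variable {X : Type*} {K : SimpleGraph X}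

/-- `IsSide K S A`: the set `A` of vertices is disjoint from `S` and is a union of components of
the complement of `S`. -/
structure IsSide (K : SimpleGraph X) (S A : Set X) : Prop where
  notMem : ∀ a ∈ A, a ∉ S
  adj : ∀ a ∈ A, ∀ b, K.Adj a b → b ∉ S → b ∈ A

variable {S A : Set X}

theorem IsSide.other (h : IsSide K S A) : IsSide K S (A ∪ S)ᶜ where
  notMem := fun _ ha hS => ha (Or.inr hS)
  adj := fun a ha b hab hb hbA =>
    hbA.elim (fun hbA => ha (Or.inl (h.adj b hbA a hab.symm fun haS => ha (Or.inr haS)))) hb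

theorem IsSide.exists_mem (h : IsSide K S A) {a b : X} (c : K.Walk a b) (ha : a ∈ A)
    (hb : b ∉ A) : ∃ r ∈ c.support, r ∈ S := by
  induction c with
  | nil => exact absurd ha hb
  | @cons a a' b hadj c ih =>
    by_cases ha' : a' ∈ S
    · exact ⟨a', by simp, ha'⟩
    · obtain ⟨r, hr, hrS⟩ := ih (h.adj a ha a' hadj ha') hb
      exact ⟨r, by simp [hr], hrS⟩

theorem IsSide.separatesGraph (h : IsSide K S A) {a b : X} (ha : a ∈ A) (hb : b ∉ A)
    (hbS : b ∉ S) : SeparatesGraph K S := by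
  intro hpre
  obtain ⟨c⟩ := hpre ⟨a, h.notMem a ha⟩ ⟨b, hbS⟩
  have key : ∀ {x y : ↥Sᶜ} (_ : (K.induce Sᶜ).Walk x y), x.1 ∈ A → y.1 ∈ A := by
    intro x y c
    induction c with
    | nil => exact fun h => h
    | @cons x x' y hadj c ih => exact fun hx => ih (h.adj _ hx _ hadj x'.2)
  exact hb (key c ha)

theorem GeodesicRay.adj (r : GeodesicRay K) (n : ℕ) : K.Adj (r.1 n) (r.1 (n + 1)) :=
  SimpleGraph.dist_eq_one_iff_adj.1 (by rw [r.2 n (n + 1) (by omega)]; omega)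

theorem GeodesicRay.injective (r : GeodesicRay K) : Function.Injective r.1 := by
  intro i j hij
  have h1 := r.2 (min i j) (max i j) (by omega)
  rcases le_total i j with h | h
  · rw [min_eq_left h, max_eq_right h, hij, SimpleGraph.dist_self] at h1
    omega
  · rw [min_eq_right h, max_eq_left h, hij, SimpleGraph.dist_self] at h1
    omega

theorem IsSide.ray_mem_iff (h : IsSide K S A) (r : GeodesicRay K) {N : ℕ}
    (hN : ∀ n, N ≤ n → r.1 n ∉ S) : ∀ n, N ≤ n → (r.1 n ∈ A ↔ r.1 N ∈ A) := by
  intro n hn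
  induction n, hn using Nat.le_induction with
  | base => rfl
  | succ n hn ih =>
    rw [← ih]
    exact ⟨fun h1 => h.adj _ h1 _ (r.adj n).symm (hN n hn),
      fun h1 => h.adj _ h1 _ (r.adj n) (hN (n + 1) (by omega))⟩

/-- A geodesic ray is eventually on one side. -/
theorem IsSide.eventually (h : IsSide K S A) (hS : S.Finite) (r : GeodesicRay K) :
    ∃ N, (∀ n, N ≤ n → r.1 n ∈ A) ∨ (∀ n, N ≤ n → r.1 n ∈ (A ∪ S)ᶜ) := by
  obtain ⟨N, hN⟩ := (hS.preimage r.injective.injOn).bddAbove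
  have hN' : ∀ n, N + 1 ≤ n → r.1 n ∉ S := fun n hn hS => by
    have := hN hS
    omega
  refine ⟨N + 1, ?_⟩
  by_cases hA : r.1 (N + 1) ∈ A
  · exact Or.inl fun n hn => (h.ray_mem_iff r hN' n hn).2 hA
  · refine Or.inr fun n hn hmem => ?_
    rcases hmem with hmem | hmem
    · exact hA ((h.ray_mem_iff r hN' n hn).1 hmem)
    · exact hN' n hn hmem

/-- The points of `Δ K` on the side `A`: the vertices in `A` and the ends of rays that are
eventually in `A`. -/
def deltaSide (K : SimpleGraph X) (A : Set X) : Set (Delta K) :=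
  {x | (∃ a ∈ A, x = .vertex a) ∨
    ∃ (r : GeodesicRay K) (N : ℕ), (∀ n, N ≤ n → r.1 n ∈ A) ∧ x = .ideal (Quotient.mk _ r)}

/-- Two rays on different sides of a separating set of two vertices are joined by a geodesic line
through one of these vertices. -/
theorem IsSide.exists_line (hK : K.Connected) {p q : X} (h : IsSide K {p, q} A)
    {r₁ r₂ : GeodesicRay K} {N₁ N₂ : ℕ} (h₁ : ∀ n, N₁ ≤ n → r₁.1 n ∈ A)
    (h₂ : ∀ n, N₂ ≤ n → r₂.1 n ∉ A) :
    ∃ l : GeodesicLine K, l.1 0 ∈ ({p, q} : Set X) ∧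
      (Quotient.mk (asymptotic K) l.neg) = Quotient.mk (asymptotic K) r₁ ∧
      (Quotient.mk (asymptotic K) l.pos) = Quotient.mk (asymptotic K) r₂ := by
  classical
  obtain ⟨Np₁, hp₁⟩ := exists_dist_stable hK p r₁
  obtain ⟨Nq₁, hq₁⟩ := exists_dist_stable hK q r₁
  obtain ⟨Np₂, hp₂⟩ := exists_dist_stable hK p r₂
  obtain ⟨Nq₂, hq₂⟩ := exists_dist_stable hK q r₂
  obtain ⟨N, n1, n2, n3, n4, n5, n6⟩ : ∃ N, N₁ ≤ N ∧ N₂ ≤ N ∧ Np₁ ≤ N ∧ Nq₁ ≤ N ∧ Np₂ ≤ N ∧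
      Nq₂ ≤ N := ⟨N₁ + N₂ + Np₁ + Nq₁ + Np₂ + Nq₂, by omega, by omega, by omega, by omega,
        by omega, by omega⟩
  have stable₁ : ∀ c ∈ ({p, q} : Set X), ∀ n,
      K.dist c (r₁.1 (N + n)) = K.dist c (r₁.1 N) + n := by
    rintro c (rfl | rfl) n
    exacts [hp₁ N n3 n, hq₁ N n4 n]
  have stable₂ : ∀ c ∈ ({p, q} : Set X), ∀ n,
      K.dist c (r₂.1 (N + n)) = K.dist c (r₂.1 N) + n := by
    rintro c (rfl | rfl) n
    exacts [hp₂ N n5 n, hq₂ N n6 n]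
  -- the line is made to pass through the better one of the two vertices
  obtain ⟨c, hc, hmin⟩ : ∃ c ∈ ({p, q} : Set X), ∀ c' ∈ ({p, q} : Set X),
      K.dist c (r₁.1 N) + K.dist c (r₂.1 N) ≤ K.dist c' (r₁.1 N) + K.dist c' (r₂.1 N) := by
    obtain ⟨c, hc, h⟩ := Set.exists_min_image ({p, q} : Set X)
      (fun c => K.dist c (r₁.1 N) + K.dist c (r₂.1 N)) (Set.toFinite _) ⟨p, by simp⟩
    exact ⟨c, hc, h⟩
  obtain ⟨s₁, h10, h11, h12⟩ := exists_ray_of_stable hK (stable₁ c hc)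
  obtain ⟨s₂, h20, h21, h22⟩ := exists_ray_of_stable hK (stable₂ c hc)
  obtain ⟨l, hl0, hl1, hl2⟩ := exists_line_of_rays hK (h10.trans h20.symm)
    (f₁ := K.dist c (r₁.1 N)) (f₂ := K.dist c (r₂.1 N)) (by
      intro n m
      rw [h11, h21]
      obtain ⟨w, hw⟩ := hK.exists_walk_length_eq_dist (r₁.1 (N + n)) (r₂.1 (N + m))
      obtain ⟨c', hc', hc'S⟩ := h.exists_mem w (h₁ _ (by omega)) (h₂ _ (by omega))
      have k1 := SimpleGraph.dist_le (w.takeUntil c' hc')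
      have k2 := SimpleGraph.dist_le (w.dropUntil c' hc')
      have k3 := congrArg SimpleGraph.Walk.length (w.take_spec hc')
      rw [SimpleGraph.Walk.length_append] at k3
      rw [SimpleGraph.dist_comm, stable₁ c' hc'S] at k1
      rw [stable₂ c' hc'S] at k2
      have := hmin c' hc'S
      omega)
  exact ⟨l, by rw [hl0, h10]; exact hc, by rw [hl1, h12], by rw [hl2, h22]⟩

/-- The neighbourhood of a point of `deltaSide K A` defined by the separating pair stays on this
side, since a geodesic to the other side meets the pair. -/
theorem IsSide.isOpen_deltaSide (hK : K.Connected) {p q : X} (h : IsSide K {p, q} A) :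
    IsOpen (deltaSide K A) := by
  intro x hx
  refine ⟨{p, q}, Set.toFinite _, fun y hy => ?_⟩
  rcases hx with ⟨a, ha, rfl⟩ | ⟨r, N, hr, rfl⟩
  · have hav : ∀ c ∈ ({p, q} : Set X), ¬ (Delta.vertex c : Delta K) = .vertex a := by
      rintro c hc hca
      injection hca with hca
      exact h.notMem a ha (hca ▸ hc)
    cases y with
    | vertex b =>
      by_contra hb
      obtain ⟨w, hw⟩ := hK.exists_walk_length_eq_dist a b
      obtain ⟨c, hc, hcS⟩ := h.exists_mem w ha fun hbA => hb (Or.inl ⟨b, hbA, rfl⟩)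
      exact hav c hcS (hy _ (.segment w hw) c hc hcS)
    | ideal ξ =>
      induction ξ using Quotient.inductionOn with
      | h r =>
      obtain ⟨s, hs0, -, hs⟩ := exists_ray_from hK a r
      rw [← hs] at hy ⊢
      have hgeo := GeodesicVertices.ray s
      rw [hs0] at hgeo
      have hmiss : ∀ n, 0 ≤ n → s.1 n ∉ ({p, q} : Set X) := fun n _ hn =>
        hav _ hn (hy _ hgeo _ ⟨n, rfl⟩ hn)
      exact Or.inr ⟨s, 0, fun n hn => (h.ray_mem_iff s hmiss n hn).2 (hs0 ▸ ha), rfl⟩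
  · cases y with
    | vertex b =>
      by_contra hb
      have hbA : b ∉ A := fun hbA => hb (Or.inl ⟨b, hbA, rfl⟩)
      obtain ⟨s, hs0, ⟨i, j, hij⟩, hs⟩ := exists_ray_from hK b r
      rw [← hs] at hy
      have hgeo := GeodesicVertices.rayBack s
      rw [hs0] at hgeo
      have hmiss : ∀ n, 0 ≤ n → s.1 n ∉ ({p, q} : Set X) := fun n _ hn => by
        have := hy _ hgeo _ ⟨n, rfl⟩ hn
        cases this
      have h1 := (h.ray_mem_iff s hmiss (i + N) (by omega)).1
        (by rw [hij]; exact hr _ (by omega))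
      exact hbA (hs0 ▸ h1)
    | ideal ξ =>
      induction ξ using Quotient.inductionOn with
      | h r' =>
      obtain ⟨N', hN' | hN'⟩ := h.eventually (Set.toFinite _) r'
      · exact Or.inr ⟨r', N', hN', rfl⟩
      · obtain ⟨l, hl0, hl1, hl2⟩ := h.exists_line hK hr fun n hn hmem =>
          hN' n hn (Or.inl hmem)
        have hgeo := GeodesicVertices.line l
        rw [hl1, hl2] at hgeo
        have := hy _ hgeo _ ⟨0, rfl⟩ hl0
        cases this

theorem IsSide.separatesSpace (hK : K.Connected) {p q : X} (h : IsSide K {p, q} A) {a b : X}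
    (ha : a ∈ A) (hb : b ∉ A) (hbS : b ∉ ({p, q} : Set X)) :
    SeparatesSpace ((Delta.vertex : X → Delta K) '' {p, q}) := by
  have hA := h.isOpen_deltaSide hK
  have hB := h.other.isOpen_deltaSide hK
  have hcompl : ((Delta.vertex : X → Delta K) '' {p, q})ᶜ =
      deltaSide K A ∪ deltaSide K (A ∪ {p, q})ᶜ := by
    ext x
    constructor
    · intro hx
      cases x with
      | vertex c =>
        by_cases hc : c ∈ A
        · exact Or.inl (Or.inl ⟨c, hc, rfl⟩)
        · exact Or.inr (Or.inl ⟨c, fun hc' => hc'.elim hc fun hcS => hx ⟨c, hcS, rfl⟩, rfl⟩)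
      | ideal ξ =>
        induction ξ using Quotient.inductionOn with
        | h r =>
        obtain ⟨N, hN | hN⟩ := h.eventually (Set.toFinite _) r
        · exact Or.inl (Or.inr ⟨r, N, hN, rfl⟩)
        · exact Or.inr (Or.inr ⟨r, N, hN, rfl⟩)
    · rintro (hx | hx) ⟨c, hc, rfl⟩
      · rcases hx with ⟨a, ha, hca⟩ | ⟨r, N, hr, hcr⟩
        · injection hca with hca
          exact h.notMem a ha (hca ▸ hc)
        · cases hcr
      · rcases hx with ⟨a, ha, hca⟩ | ⟨r, N, hr, hcr⟩
        · injection hca with hca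
          exact ha (Or.inr (hca ▸ hc))
        · cases hcr
  refine ⟨⟨by rw [hcompl]; exact hA.union hB⟩, fun hpre => ?_⟩
  rw [hcompl] at hpre
  obtain ⟨x, -, hxA, hxB⟩ := hpre _ _ hA hB subset_rfl
    ⟨.vertex a, Or.inl (Or.inl ⟨a, ha, rfl⟩), Or.inl ⟨a, ha, rfl⟩⟩
    ⟨.vertex b, Or.inr (Or.inl ⟨b, fun hb' => hb'.elim hb hbS, rfl⟩),
      Or.inl ⟨b, fun hb' => hb'.elim hb hbS, rfl⟩⟩
  rcases hxA with ⟨c, hc, rfl⟩ | ⟨r, N, hr, rfl⟩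
  · rcases hxB with ⟨c', hc', hcc⟩ | ⟨r, N, hr, hcr⟩
    · injection hcc with hcc
      exact hc' (Or.inl (hcc ▸ hc))
    · cases hcr
  · rcases hxB with ⟨c', hc', hcc⟩ | ⟨r', N', hr', hcr⟩
    · cases hcc
    -- asymptotic rays on different sides would stay close to the separating pair
    · injection hcr with hcr
      obtain ⟨C, hC⟩ := Quotient.exact hcr
      set n := N + N' + C + K.dist (r.1 0) p + K.dist (r.1 0) q + 1 with hn
      have hCn := hC n
      rw [← (hK.preconnected _ _).coe_dist_eq_edist, Nat.cast_le] at hCn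
      obtain ⟨w, hw⟩ := hK.exists_walk_length_eq_dist (r.1 n) (r'.1 n)
      obtain ⟨c, hc, hcS⟩ := h.exists_mem w (hr n (by omega)) fun hA =>
        hr' n (by omega) (Or.inl hA)
      classical
      have k1 := SimpleGraph.dist_le (w.takeUntil c hc)
      have k2 := w.length_takeUntil_le_length hc
      have k3 := r.2 0 n (by omega)
      have k4 := hK.dist_triangle (u := r.1 0) (v := c) (w := r.1 n)
      rw [SimpleGraph.dist_comm (u := c)] at k4
      rcases hcS with rfl | rfl <;> omega

end EdgeSeparation

namespace TreeDecomposition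

variable {U P : Type*} {T : SimpleGraph U} {W : Set U} {K : SimpleGraph P} {piece : U → Set P}

/-- A red piece separates the graph, with points on at least two sides. -/
theorem exists_isSide (D : TreeDecomposition T W K piece) {w : U} (hw : w ∈ W) :
    ∃ A : Set P, IsSide K (piece w) A ∧ A.Nonempty ∧ ∃ b, b ∉ A ∧ b ∉ piece w := by
  obtain ⟨v₁, h₁, v₂, h₂, hne⟩ := D.valence w
  rw [SimpleGraph.mem_neighborSet] at h₁ h₂
  have hpt : ∀ v, T.Adj w v → ∃ a ∈ piece v, a ∉ piece w := by
    intro v hv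
    obtain ⟨w', hw', hne⟩ := (D.valence v).exists_ne w
    rw [SimpleGraph.mem_neighborSet] at hw'
    have hw'W : w' ∈ W := by
      by_contra hcon
      exact (D.bipartite hv).1 hw ((D.bipartite hw').2 hcon)
    obtain ⟨p, q, hpq, hpiece⟩ := D.red_pair hw'W
    have hp : p ∈ piece w' := by simp [hpiece]
    have hq : q ∈ piece w' := by simp [hpiece]
    by_cases hpw : p ∈ piece w
    · refine ⟨q, D.red_sub hw'W hw' hq, fun hqw => hpq.ne ?_⟩
      exact D.red_inter hw hw'W hne.symm ⟨hpw, hp⟩ ⟨hqw, hq⟩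
    · exact ⟨p, D.red_sub hw'W hw' hp, hpw⟩
  obtain ⟨a, ha, haw⟩ := hpt v₁ h₁
  obtain ⟨b, hb, hbw⟩ := hpt v₂ h₂
  have hsep : Sep T w v₁ v₂ := by
    refine sep_of_mem_path D.isTree.isAcyclic
      (p := .cons h₁.symm (.cons h₂ .nil)) ?_ (by simp)
    simp [SimpleGraph.Walk.cons_isPath_iff, h₁.ne', h₂.ne, hne]
  refine ⟨{p | p ∉ piece w ∧ ∃ u, p ∈ piece u ∧ ¬ Sep T w u v₁}, ⟨fun _ hp => hp.1, ?_⟩,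
    ⟨a, haw, v₁, ha, fun h => ?_⟩, b, ?_, hbw⟩
  · rintro p ⟨hp, u, hpu, hu⟩ q hpq hq
    obtain ⟨u', hpu', hqu'⟩ := D.edge hpq
    refine ⟨hq, u', hqu', fun h => ?_⟩
    rcases h.cotrans u with h' | h'
    · exact hp (D.convex hpu' hpu h')
    · exact hu h'
  · have := h .nil
    simp only [SimpleGraph.Walk.support_nil, List.mem_singleton] at this
    exact h₁.ne this
  · rintro ⟨-, u, hbu, hu⟩
    refine hbw (D.convex hbu hb ?_)
    rcases hsep.cotrans u with h | h
    · exact absurd h.symm hu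
    · exact h

theorem separates (D : TreeDecomposition T W K piece) (hK : K.Connected) {w : U} (hw : w ∈ W) :
    SeparatesGraph K (piece w) ∧
      SeparatesSpace ((Delta.vertex : P → Delta K) '' piece w) := by
  obtain ⟨A, hA, ⟨a, ha⟩, b, hb, hbw⟩ := D.exists_isSide hw
  refine ⟨hA.separatesGraph ha hb hbw, ?_⟩
  obtain ⟨p, q, -, hpq⟩ := D.red_pair hw
  rw [hpq] at hA hbw ⊢
  exact hA.separatesSpace hK ha hb hbw

end TreeDecomposition

/-! ### The parabolic forest -/

section Forest

variable {G U L : Type*} [Group G] [MulAction G U] [MulAction G L] {A : AdmissibleAction G U L}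

theorem AdmissibleAction.mem_V_iff (A : AdmissibleAction G U L) {u : U} : u ∈ A.V ↔ u ∉ A.W := by
  have h1 : u ∈ A.V ∪ A.W := by rw [A.union_eq]; trivial
  have h2 := A.bipartite.disjoint
  exact ⟨fun hV hW => Set.disjoint_left.1 h2 hV hW, fun hW => h1.resolve_right hW⟩

theorem AdmissibleAction.mem_W_iff_of_adj (A : AdmissibleAction G U L) {u u' : U}
    (h : A.T.Adj u u') : u ∈ A.W ↔ u' ∉ A.W := by
  rcases A.bipartite.mem_of_adj h with ⟨h1, h2⟩ | ⟨h1, h2⟩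
  · exact ⟨fun h => absurd h (A.mem_V_iff.1 h1), fun h => absurd h2 h⟩
  · exact ⟨fun _ => A.mem_V_iff.1 h2, fun _ => h1⟩

theorem AdmissibleAction.smul_mem_W_iff (A : AdmissibleAction G U L) (g : G) {u : U} :
    g • u ∈ A.W ↔ u ∈ A.W := by
  refine ⟨fun h => ?_, A.smul_mem_W g u⟩
  have := A.smul_mem_W g⁻¹ _ h
  rwa [inv_smul_smul] at this

namespace Signature

variable (S : Signature A)

theorem s_congr {v v' w w' : U} (hw : w ∈ A.W) (h : A.T.Adj v w) (hw' : w' ∈ A.W)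
    (h' : A.T.Adj v' w') {z : Fiber A.π w} {z' : Fiber A.π w'} (hz : z.1 = z'.1) (hv : v = v') :
    (S.s hw h z).1 = (S.s hw' h' z').1 := by
  subst hv
  obtain rfl : w = w' := by rw [← z.2, ← z'.2, hz]
  obtain rfl : z = z' := Subtype.ext hz
  rfl

theorem s_inj {v v' w w' : U} (hw : w ∈ A.W) (h : A.T.Adj v w) (hw' : w' ∈ A.W)
    (h' : A.T.Adj v' w') {z : Fiber A.π w} {z' : Fiber A.π w'}
    (hs : (S.s hw h z).1 = (S.s hw' h' z').1) (hww : w = w') : z.1 = z'.1 := by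
  subst hww
  obtain rfl : v = v' := by rw [← (S.s hw h z).2, ← (S.s hw' h' z').2, hs]
  exact congrArg Subtype.val (S.injective hw h (Subtype.ext hs))

variable {S} in
theorem Rel.adj {x y : L} (h : S.Rel x y) : A.T.Adj (A.π y) (A.π x) ∧ A.π x ∈ A.W := by
  obtain ⟨v, w, hw, h, z, rfl, rfl⟩ := h
  have h1 : A.π z.1 = w := z.2
  have h2 : A.π (S.s hw h z).1 = v := (S.s hw h z).2
  rw [h1, h2]
  exact ⟨h, hw⟩

variable {S} in
theorem Rel.forest_adj {x y : L} (h : S.Rel x y) : S.forest.Adj x y := by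
  rw [forest, SimpleGraph.fromRel_adj]
  exact ⟨fun e => h.adj.1.ne (by rw [e]), Or.inl h⟩

/-- The projection of the parabolic forest to the tree. -/
def forestHom : S.forest →g A.T where
  toFun := A.π
  map_rel' := fun {x y} h => by
    rw [forest, SimpleGraph.fromRel_adj] at h
    exact h.2.elim (fun h => h.adj.1.symm) fun h => h.adj.1

variable {S} in
/-- The projection of the parabolic forest to the tree is locally injective: over an edge
`(v, w)` of the tree, the edges of the forest are the graph of an injective map. -/
theorem forest_adj_inj {x y y' : L} (h : S.forest.Adj x y) (h' : S.forest.Adj x y')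
    (hy : A.π y = A.π y') : y = y' := by
  rw [forest, SimpleGraph.fromRel_adj] at h h'
  rcases h.2 with h | h <;> rcases h'.2 with h' | h'
  · obtain ⟨v, w, hw, e, z, rfl, rfl⟩ := h
    obtain ⟨v', w', hw', e', z', hz, rfl⟩ := h'
    exact S.s_congr hw e hw' e' hz (((S.s hw e z).2.symm.trans hy).trans (S.s hw' e' z').2)
  · exact absurd h'.adj.2 (hy ▸ (A.mem_W_iff_of_adj h.adj.1.symm).1 h.adj.2)
  · exact absurd h.adj.2 (hy ▸ (A.mem_W_iff_of_adj h'.adj.1.symm).1 h'.adj.2)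
  · obtain ⟨v, w, hw, e, z, rfl, rfl⟩ := h
    obtain ⟨v', w', hw', e', z', rfl, hz⟩ := h'
    exact S.s_inj hw e hw' e' hz ((z.2.symm.trans hy).trans z'.2)

variable {S} in
theorem map_isPath {x y : L} {p : S.forest.Walk x y} (hp : p.IsPath) :
    (p.map S.forestHom).IsPath := by
  induction p with
  | nil => simp
  | @cons x x₁ y h p ih =>
    rw [SimpleGraph.Walk.cons_isPath_iff] at hp
    rw [SimpleGraph.Walk.map_cons, SimpleGraph.Walk.cons_isPath_iff]
    refine ⟨ih hp.1, fun hmem => ?_⟩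
    -- a path that returns to `π x` does so at once, contradicting local injectivity
    have hsnd := A.isTree.isAcyclic.eq_snd_of_adj_start (ih hp.1) (S.forestHom.map_adj h).symm hmem
    cases p with
    | nil =>
      simp only [SimpleGraph.Walk.map_nil, SimpleGraph.Walk.support_nil,
        List.mem_singleton] at hmem
      exact (S.forestHom.map_adj h).ne hmem
    | @cons _ x₂ _ h' p =>
      simp only [SimpleGraph.Walk.map_cons, SimpleGraph.Walk.snd_cons] at hsnd
      have := forest_adj_inj h' h.symm hsnd.symm
      exact hp.2 (by rw [← this]; simp)

variable {S} in
theorem eq_of_reachable {x y : L} (h : S.forest.Reachable x y) (hxy : A.π x = A.π y) : x = y := by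
  classical
  obtain ⟨p⟩ := h
  have hp := map_isPath p.bypass_isPath
  have hnil : ∀ {u u' : U} (q : A.T.Walk u u'), q.IsPath → u = u' → q.length = 0 := by
    rintro u _ q hq rfl
    exact SimpleGraph.Walk.length_eq_zero_iff.2 (SimpleGraph.Walk.isPath_iff_nil.1 hq)
  have := hnil _ hp hxy
  rw [SimpleGraph.Walk.length_map] at this
  exact SimpleGraph.Walk.eq_of_length_eq_zero this

theorem forest_isAcyclic : S.forest.IsAcyclic := by
  rw [SimpleGraph.isAcyclic_iff_subsingleton_path]
  refine fun x y => ⟨fun p q => ?_⟩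
  have h := (A.isTree.isAcyclic.subsingleton_path _ _).elim
    (⟨_, map_isPath p.2⟩ : A.T.Path (S.forestHom x) (S.forestHom y)) ⟨_, map_isPath q.2⟩
  refine Subtype.ext (SimpleGraph.Walk.ext_getVert fun k => ?_)
  replace h := congrArg (fun r => r.1.getVert k) h
  exact eq_of_reachable ((p.1.take k).reachable.symm.trans (q.1.take k).reachable)
    ((SimpleGraph.Walk.getVert_map ..).symm.trans (h.trans (SimpleGraph.Walk.getVert_map ..)))

theorem cls_eq_cls_iff {x y : L} : S.cls x = S.cls y ↔ S.forest.Reachable x y := by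
  constructor
  · intro h
    have key : ∀ {x y}, Relation.EqvGen S.Rel x y → S.forest.Reachable x y := by
      intro x y h
      induction h with
      | rel x y h => exact h.forest_adj.reachable
      | refl x => exact .rfl
      | symm x y _ ih => exact ih.symm
      | trans x y z _ _ ih ih' => exact ih.trans ih'
    exact key (Quot.eqvGen_exact h)
  · rintro ⟨p⟩
    induction p with
    | nil => rfl
    | cons h p ih =>
      rw [← ih]
      rw [forest, SimpleGraph.fromRel_adj] at h
      exact h.2.elim (fun h => Quot.sound h) fun h => (Quot.sound h).symm

theorem cls_injOn {x y : L} (h : S.cls x = S.cls y) (hxy : A.π x = A.π y) : x = y :=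
  eq_of_reachable (S.cls_eq_cls_iff.1 h) hxy

theorem cls_injective (u : U) : Function.Injective fun x : Fiber A.π u => S.cls x.1 :=
  fun x y h => Subtype.ext (S.cls_injOn h (x.2.trans y.2.symm))

/-- The points of the quotient are the parabolic trees, equivariantly. -/
theorem exists_equiv : ∃ φ : S.Points ≃ S.ParabolicTree,
      (∀ x : L, φ (S.cls x) = S.treeOf x) ∧
      (∀ (g : G) (p : S.Points), φ (g • p) = g • φ p) ∧
      ∀ p : S.Points, MulAction.stabilizer G p = MulAction.stabilizer G (φ p) := by
  let f : S.Points → S.ParabolicTree := Quot.lift S.treeOf fun x y h =>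
    SimpleGraph.ConnectedComponent.sound h.forest_adj.reachable
  have hf : Function.Bijective f := by
    constructor
    · intro p q h
      induction p using Quot.inductionOn
      induction q using Quot.inductionOn
      exact S.cls_eq_cls_iff.2 (SimpleGraph.ConnectedComponent.exact h)
    · intro C
      induction C using SimpleGraph.ConnectedComponent.ind with
      | h x => exact ⟨S.cls x, rfl⟩
  have hsmul : ∀ (g : G) (p : S.Points), f (g • p) = g • f p := by
    intro g p
    induction p using Quot.inductionOn
    rfl
  refine ⟨Equiv.ofBijective f hf, fun x => rfl, hsmul, fun p => ?_⟩
  ext g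
  rw [mem_stabilizer_iff, mem_stabilizer_iff, Equiv.ofBijective_apply, ← hsmul]
  exact hf.1.eq_iff.symm

/-! ### The images of the sets `Λ_u` in the quotient -/

theorem smul_cls (g : G) (x : L) : g • S.cls x = S.cls (g • x) := rfl

theorem exists_cls (p : S.Points) : ∃ x, S.cls x = p := Quot.exists_rep p

variable {S} in
theorem mem_piece {u : U} {p : S.Points} : p ∈ S.piece u ↔ ∃ x, A.π x = u ∧ S.cls x = p :=
  ⟨fun ⟨x, hx⟩ => ⟨x.1, x.2, hx⟩, fun ⟨x, hu, hx⟩ => ⟨⟨x, hu⟩, hx⟩⟩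

theorem cls_mem_piece {u : U} (x : Fiber A.π u) : S.cls x.1 ∈ S.piece u := ⟨x, rfl⟩

variable {S} in
theorem smul_mem_piece (g : G) {u : U} {p : S.Points} (h : p ∈ S.piece u) :
    g • p ∈ S.piece (g • u) := by
  obtain ⟨x, rfl⟩ := h
  exact ⟨x.translate g, rfl⟩

theorem piece_convex {p : S.Points} {u u' m : U} (h : p ∈ S.piece u) (h' : p ∈ S.piece u')
    (hm : Sep A.T m u u') : p ∈ S.piece m := by
  obtain ⟨x, rfl, rfl⟩ := mem_piece.1 h
  obtain ⟨y, rfl, hxy⟩ := mem_piece.1 h'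
  obtain ⟨c⟩ := S.cls_eq_cls_iff.1 hxy.symm
  obtain ⟨z, hz, rfl⟩ := List.mem_map.1
    ((SimpleGraph.Walk.support_map S.forestHom c) ▸ hm (c.map S.forestHom))
  classical
  exact mem_piece.2 ⟨z, rfl, S.cls_eq_cls_iff.2 (c.takeUntil z hz).reachable.symm⟩

theorem cls_s {v w : U} (hw : w ∈ A.W) (h : A.T.Adj v w) (z : Fiber A.π w) :
    S.cls (S.s hw h z).1 = S.cls z.1 :=
  (Quot.sound ⟨v, w, hw, h, z, rfl, rfl⟩ : S.cls z.1 = _).symm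

variable {S} in
theorem exists_s_eq {v w : U} (hw : w ∈ A.W) (h : A.T.Adj v w) {a : Fiber A.π v}
    (ha : S.cls a.1 ∈ S.piece w) : ∃ z, a = S.s hw h z := by
  obtain ⟨z, hz⟩ := ha
  exact ⟨z, S.cls_injective v (hz.symm.trans (S.cls_s hw h z).symm)⟩

theorem piece_red_sub {v w : U} (hw : w ∈ A.W) (h : A.T.Adj v w) : S.piece w ⊆ S.piece v := by
  rintro _ ⟨z, rfl⟩
  exact ⟨S.s hw h z, S.cls_s hw h z⟩

variable {S} in
theorem isNeck_of_mem_piece {v w : U} (hw : w ∈ A.W) (h : A.T.Adj v w) {a b : Fiber A.π v}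
    (hab : a ≠ b) (ha : S.cls a.1 ∈ S.piece w) (hb : S.cls b.1 ∈ S.piece w) : S.IsNeck a b := by
  obtain ⟨x, rfl⟩ := exists_s_eq hw h ha
  obtain ⟨y, rfl⟩ := exists_s_eq hw h hb
  exact ⟨w, hw, h, x, y, fun e => hab (by rw [e]), rfl, rfl⟩

/-- Two adjacent red vertices of the same white vertex share at most one point, and pieces are
convex; so any two red pieces share at most one point. -/
theorem piece_red_inter {w w' : U} (hw : w ∈ A.W) (hw' : w' ∈ A.W) (hne : w ≠ w') :
    (S.piece w ∩ S.piece w').Subsingleton := by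
  rintro p ⟨hp, hp'⟩ q ⟨hq, hq'⟩
  obtain ⟨v, hwv, hsep⟩ := exists_adj_sep A.isTree hne
  have hv : v ∉ A.W := (A.mem_W_iff_of_adj hwv).1 hw
  have hvw' : v ≠ w' := fun e => hv (e ▸ hw')
  obtain ⟨w'', hvw'', hsep'⟩ := exists_adj_sep A.isTree hvw'
  have hw'' : w'' ∈ A.W := by
    by_contra h
    exact hv ((A.mem_W_iff_of_adj hvw'').2 h)
  have hww : w ≠ w'' := by
    rintro rfl
    have h1 := hsep.dist A.isTree.connected
    have h2 := hsep'.dist A.isTree.connected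
    rw [SimpleGraph.dist_eq_one_iff_adj.2 hwv] at h1
    rw [SimpleGraph.dist_eq_one_iff_adj.2 hvw''] at h2
    omega
  have hpv := S.piece_red_sub hw hwv.symm hp
  have hqv := S.piece_red_sub hw hwv.symm hq
  have hp'' := S.piece_convex hpv hp' hsep'
  have hq'' := S.piece_convex hqv hq' hsep'
  obtain ⟨a, rfl⟩ := hpv
  obtain ⟨b, rfl⟩ := hqv
  obtain ⟨x, hx⟩ := exists_s_eq hw hwv.symm hp
  obtain ⟨y, hy⟩ := exists_s_eq hw hwv.symm hq
  obtain ⟨x', hx'⟩ := exists_s_eq hw'' hvw'' hp''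
  obtain ⟨y', hy'⟩ := exists_s_eq hw'' hvw'' hq''
  have hab : a.1 = b.1 := S.inter hw hwv.symm hw'' hvw'' (fun e => hww (Prod.mk.inj e).2)
    ⟨⟨x, congrArg Subtype.val hx.symm⟩, ⟨x', congrArg Subtype.val hx'.symm⟩⟩
    ⟨⟨y, congrArg Subtype.val hy.symm⟩, ⟨y', congrArg Subtype.val hy'.symm⟩⟩
  exact congrArg S.cls hab

end Signature

theorem AdmissibleAction.exists_pair (hA : A.IsNAdmissible 2) {w : U} (hw : w ∈ A.W) :
    ∃ x y : Fiber A.π w, x ≠ y ∧ ∀ z, z = x ∨ z = y := by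
  obtain ⟨x, y, hxy, h⟩ := Nat.card_eq_two_iff.1 (hA w hw)
  exact ⟨x, y, hxy, fun z => by simpa using (Set.ext_iff.1 h z).2 trivial⟩

theorem AdmissibleAction.finite_stabilizer_of_red (hA : A.IsNAdmissible 2) {w : U}
    (hw : w ∈ A.W) : Finite (stabilizer G w) := by
  obtain ⟨x, y, hxy, -⟩ := AdmissibleAction.exists_pair hA hw
  exact A.finite_stabilizer w hw ⟨x, y, hxy⟩

/-- Red vertices have finite valence. -/
theorem AdmissibleAction.finite_neighborSet (hA : A.IsNAdmissible 2) {w : U} (hw : w ∈ A.W) :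
    (A.T.neighborSet w).Finite := by
  obtain ⟨R, hR, h⟩ := A.finiteQuotient.2
  have hst := AdmissibleAction.finite_stabilizer_of_red hA hw
  have hfin : ∀ e : U × U, {g : G | g • e.1 = w}.Finite := by
    intro e
    refine (finite_setOf_smul_eq hst e.1).inv.subset fun g hg => ?_
    rw [Set.mem_inv]
    exact inv_smul_eq_iff.2 (Eq.symm hg)
  refine (hR.biUnion fun e _ => (hfin e).image (· • e.2)).subset fun v hv => ?_
  obtain ⟨e, he, g, hg⟩ := h w v hv
  exact Set.mem_biUnion he ⟨g, congrArg Prod.fst hg, congrArg Prod.snd hg⟩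

end Forest

/-! ### The combined graph -/

section Combined

variable {G U L : Type*} [Group G] [MulAction G U] [MulAction G L] {A : AdmissibleAction G U L}

theorem AdmissibleAction.fg_stabilizer (A : AdmissibleAction G U L) (x : L) :
    (stabilizer G x).FG := by
  obtain ⟨-, K, hK⟩ := A.relativelyHyperbolic (A.π x)
  let x' : Fiber A.π (A.π x) := ⟨x, rfl⟩
  have : stabilizer G x = (stabilizer (stabilizer G (A.π x)) x').map
      (stabilizer G (A.π x)).subtype := by
    ext g
    rw [mem_stabilizer_iff, Subgroup.mem_map]
    constructor
    · intro hg
      exact ⟨⟨g, by rw [mem_stabilizer_iff, ← map_smul, hg]⟩, Subtype.ext hg, rfl⟩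
    · rintro ⟨k, hk, rfl⟩
      exact congrArg Subtype.val hk
  rw [this]
  exact fg_map (hK.fg_vertex_stabilizer _) _

namespace Signature

variable {S : Signature A}

theorem IsNeck.mem_piece {v : U} {a b : Fiber A.π v} (h : S.IsNeck a b) :
    ∃ w ∈ A.W, A.T.Adj v w ∧ ∃ x y : Fiber A.π w, x ≠ y ∧ S.cls x.1 = S.cls a.1 ∧
      S.cls y.1 = S.cls b.1 := by
  obtain ⟨w, hw, h, x, y, hxy, rfl, rfl⟩ := h
  exact ⟨w, hw, h, x, y, hxy, (S.cls_s hw h x).symm, (S.cls_s hw h y).symm⟩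

theorem IsNeck.ne {v : U} {a b : Fiber A.π v} (h : S.IsNeck a b) : a ≠ b := by
  obtain ⟨w, hw, h, x, y, hxy, rfl, rfl⟩ := h
  exact fun e => hxy (S.injective hw h e)

theorem not_isNeck_of_red {w : U} (hw : w ∈ A.W) (a b : Fiber A.π w) : ¬ S.IsNeck a b :=
  fun ⟨_, hw', h, _⟩ => (A.mem_W_iff_of_adj h).1 hw hw'

theorem IsNeck.translate {v : U} {a b : Fiber A.π v} (h : S.IsNeck a b) (g : G) :
    S.IsNeck (a.translate g) (b.translate g) := by
  obtain ⟨w, hw, h, x, y, hxy, rfl, rfl⟩ := h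
  refine ⟨g • w, A.smul_mem_W g w hw, A.actsOn g v w h, x.translate g, y.translate g, ?_,
    (S.equivariant g hw h x).symm, (S.equivariant g hw h y).symm⟩
  intro e
  exact hxy (Subtype.ext (MulAction.injective g (congrArg Subtype.val e)))

theorem exists_smul_cls_eq {g : G} {u : U} {p : S.Points} (hp : p ∈ S.piece (g • u)) :
    ∃ a : Fiber A.π u, g • S.cls a.1 = p := by
  have := smul_mem_piece g⁻¹ hp
  rw [inv_smul_smul] at this
  obtain ⟨a, ha⟩ := this
  exact ⟨a, (congrArg (g • ·) ha).trans (smul_inv_smul g p)⟩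

/-- Being a neck depends only on the underlying points. -/
theorem IsNeck.congr {v v' : U} {a b : Fiber A.π v} {a' b' : Fiber A.π v'} (ha : a.1 = a'.1)
    (hb : b.1 = b'.1) (h : S.IsNeck a b) : S.IsNeck a' b' := by
  obtain rfl : v = v' := by rw [← a.2, ← a'.2, ha]
  obtain rfl : a = a' := Subtype.ext ha
  obtain rfl : b = b' := Subtype.ext hb
  exact h

namespace VertexGraphs

variable (R : S.VertexGraphs)

theorem connected (hA : A.IsNAdmissible 2) (u : U) : (R.K u).Connected := by
  by_cases hu : u ∈ A.W
  · rw [R.junction u hu]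
    obtain ⟨x, -⟩ := AdmissibleAction.exists_pair hA hu
    have : Nonempty (Fiber A.π u) := ⟨x⟩
    exact SimpleGraph.connected_top
  · exact (R.isPeripheralGraph u (A.mem_V_iff.2 hu)).connected

/-- The graphs `K_u` are induced subgraphs of the combined graph: two points that lie in a further
piece lie in a red piece next to `u`, so they form a neck, and necks are edges of `K_u`. -/
theorem combined_adj_iff {u : U} (a b : Fiber A.π u) :
    R.combined.Adj (S.cls a.1) (S.cls b.1) ↔ (R.K u).Adj a b := by
  constructor
  · rintro ⟨hne, u', a', b', ha, hb, hab, hn⟩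
    have hne' : a ≠ b := fun e => hne (by rw [e])
    by_cases hu : u ∈ A.W
    · rw [R.junction u hu]
      exact hne'
    by_cases huu : u = u'
    · subst huu
      rw [← S.cls_injective u ha, ← S.cls_injective u hb]
      exact hab
    · obtain ⟨w, huw, hsep⟩ := exists_adj_sep A.isTree huu
      have hw : w ∈ A.W := by
        by_contra hw
        exact hu ((A.mem_W_iff_of_adj huw).2 hw)
      refine R.neck_adj u (A.mem_V_iff.2 hu) a b (isNeck_of_mem_piece hw huw hne' ?_ ?_)
      · exact S.piece_convex (S.cls_mem_piece a) (ha ▸ S.cls_mem_piece a') hsep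
      · exact S.piece_convex (S.cls_mem_piece b) (hb ▸ S.cls_mem_piece b') hsep
  · intro hab
    refine ⟨fun e => hab.ne (S.cls_injective u e), ?_⟩
    by_cases hn : S.IsNeck a b
    · obtain ⟨w, hw, -, x, y, hxy, hx, hy⟩ := hn.mem_piece
      refine ⟨w, x, y, hx, hy, ?_, not_isNeck_of_red hw x y⟩
      rw [R.junction w hw]
      exact hxy
    · exact ⟨u, a, b, rfl, rfl, hab, hn⟩

/-- The inclusion of `K_u` into the combined graph. -/
def inclusion (u : U) : R.K u →g R.combined where
  toFun := fun x => S.cls x.1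
  map_rel' := fun h => (R.combined_adj_iff _ _).2 h

theorem treeDecomposition (hA : A.IsNAdmissible 2) :
    TreeDecomposition A.T A.W R.combined S.piece where
  isTree := A.isTree
  valence := A.valence
  bipartite := A.mem_W_iff_of_adj
  exists_piece := fun p => by
    obtain ⟨x, rfl⟩ := S.exists_cls p
    exact ⟨A.π x, mem_piece.2 ⟨x, rfl, rfl⟩⟩
  convex := S.piece_convex
  edge := fun {p q} h => by
    obtain ⟨-, u, a, b, rfl, rfl, -⟩ := h
    exact ⟨u, S.cls_mem_piece a, S.cls_mem_piece b⟩
  red_sub := S.piece_red_sub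
  red_pair := fun {w} hw => by
    obtain ⟨x, y, hxy, h⟩ := AdmissibleAction.exists_pair hA hw
    refine ⟨S.cls x.1, S.cls y.1, (R.combined_adj_iff x y).2 (by rw [R.junction w hw]; exact hxy),
      ?_⟩
    ext p
    constructor
    · rintro ⟨z, rfl⟩
      rcases h z with rfl | rfl
      exacts [Or.inl rfl, Or.inr rfl]
    · rintro (rfl | rfl)
      exacts [S.cls_mem_piece x, S.cls_mem_piece y]
  red_inter := S.piece_red_inter

/-- Walks in the piece of `u` come from walks in `K_u`. -/
theorem exists_lift_walk {u : U} {p q : S.Points} (c : R.combined.Walk p q)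
    (hc : ∀ r ∈ c.support, r ∈ S.piece u) (a : Fiber A.π u) (ha : S.cls a.1 = p) :
    ∃ (b : Fiber A.π u) (c' : (R.K u).Walk a b), S.cls b.1 = q ∧ c'.length = c.length ∧
      ∀ x ∈ c'.support, S.cls x.1 ∈ c.support := by
  induction c generalizing a with
  | nil => exact ⟨a, .nil, ha, rfl, by simpa using ha⟩
  | @cons p p' q h c ih =>
    subst ha
    obtain ⟨a', rfl⟩ := hc p' (by simp)
    obtain ⟨b, c', hb, hl, hs⟩ := ih (fun r hr => hc r (by simp [hr])) a' rfl
    refine ⟨b, .cons ((R.combined_adj_iff a a').1 h) c', hb, by simp [hl], ?_⟩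
    intro x hx
    rw [SimpleGraph.Walk.support_cons, List.mem_cons] at hx ⊢
    rcases hx with rfl | hx
    · exact Or.inl rfl
    · exact Or.inr (hs x hx)

theorem isConvexSubgraph (hA : A.IsNAdmissible 2) (u : U) :
    IsConvexSubgraph (R.K u) R.combined fun x => S.cls x.1 := by
  refine ⟨S.cls_injective u, R.combined_adj_iff, fun a b c hc => ?_⟩
  exact (R.treeDecomposition hA).mem_piece_of_geodesic (S.cls_mem_piece a) (S.cls_mem_piece b) c hc

theorem combined_connected (hA : A.IsNAdmissible 2) : R.combined.Connected := by
  have hu : ∀ u (p q : S.Points), p ∈ S.piece u → q ∈ S.piece u → R.combined.Reachable p q := by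
    rintro u _ _ ⟨a, rfl⟩ ⟨b, rfl⟩
    exact ((R.connected hA u).preconnected a b).map (R.inclusion u)
  have hne : ∀ {u u'}, A.T.Adj u u' → ∃ p, p ∈ S.piece u ∧ p ∈ S.piece u' := by
    intro u u' h
    by_cases hu : u ∈ A.W
    · obtain ⟨x, -⟩ := AdmissibleAction.exists_pair hA hu
      exact ⟨_, S.cls_mem_piece x, S.piece_red_sub hu h.symm (S.cls_mem_piece x)⟩
    · have hu' : u' ∈ A.W := by
        by_contra hu'
        exact hu ((A.mem_W_iff_of_adj h).2 hu')
      obtain ⟨x, -⟩ := AdmissibleAction.exists_pair hA hu'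
      exact ⟨_, S.piece_red_sub hu' h (S.cls_mem_piece x), S.cls_mem_piece x⟩
  have key : ∀ {u u'} (_ : A.T.Walk u u') (p q : S.Points), p ∈ S.piece u → q ∈ S.piece u' →
      R.combined.Reachable p q := by
    intro u u' c
    induction c with
    | nil => exact hu _
    | cons h c ih =>
      intro p q hp hq
      obtain ⟨r, hr, hr'⟩ := hne h
      exact (hu _ p r hp hr).trans (ih r q hr' hq)
  obtain ⟨u⟩ := A.isTree.connected.nonempty
  obtain ⟨u', h⟩ := (A.valence u).nonempty
  obtain ⟨p, -⟩ := hne h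
  have : Nonempty S.Points := ⟨p⟩
  refine ⟨fun p q => ?_⟩
  obtain ⟨x, rfl⟩ := S.exists_cls p
  obtain ⟨y, rfl⟩ := S.exists_cls q
  obtain ⟨c⟩ := A.isTree.connected.preconnected (A.π x) (A.π y)
  exact key c _ _ (mem_piece.2 ⟨x, rfl, rfl⟩) (mem_piece.2 ⟨y, rfl, rfl⟩)

/-- The graphs `K_u` are isometrically embedded in the combined graph. -/
theorem combined_dist (hA : A.IsNAdmissible 2) {u : U} (a b : Fiber A.π u) :
    R.combined.dist (S.cls a.1) (S.cls b.1) = (R.K u).dist a b := by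
  apply le_antisymm
  · obtain ⟨c, hc⟩ := (R.connected hA u).exists_walk_length_eq_dist a b
    rw [← hc, ← SimpleGraph.Walk.length_map (R.inclusion u) c]
    exact SimpleGraph.dist_le _
  · obtain ⟨c, hc⟩ := (R.combined_connected hA).exists_walk_length_eq_dist
      (S.cls a.1) (S.cls b.1)
    obtain ⟨b', c', hb', hl, -⟩ := R.exists_lift_walk c
      ((R.treeDecomposition hA).mem_piece_of_geodesic (S.cls_mem_piece a) (S.cls_mem_piece b)
        c hc) a rfl
    obtain rfl := S.cls_injective u hb'
    rw [← hc, ← hl]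
    exact SimpleGraph.dist_le c'

theorem combined_actsOn : ActsOn G R.combined := by
  rintro g _ _ ⟨hne, u, a, b, rfl, rfl, hab, hn⟩
  refine ⟨fun e => hne (MulAction.injective g e), g • u, a.translate g, b.translate g, rfl, rfl,
    R.equivariant g u a b hab, fun h => hn ?_⟩
  exact (h.translate g⁻¹).congr (inv_smul_smul g a.1) (inv_smul_smul g b.1)

theorem combined_dist_smul (g : G) (p q : S.Points) :
    R.combined.dist (g • p) (g • q) = R.combined.dist p q := by
  have key : ∀ (g : G) (p q : S.Points), R.combined.Reachable p q →
      R.combined.dist (g • p) (g • q) ≤ R.combined.dist p q := by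
    intro g p q h
    obtain ⟨c, hc⟩ := h.exists_walk_length_eq_dist
    obtain ⟨c', hc', -⟩ := R.combined_actsOn.exists_smul_walk g c
    rw [← hc, ← hc']
    exact SimpleGraph.dist_le c'
  by_cases h : R.combined.Reachable p q
  · refine le_antisymm (key g p q h) ?_
    have := key g⁻¹ _ _ (R.combined_actsOn.reachable_smul g h)
    rwa [inv_smul_smul, inv_smul_smul] at this
  · rw [SimpleGraph.dist_eq_zero_of_not_reachable h,
      SimpleGraph.dist_eq_zero_of_not_reachable fun h' => h ?_]
    have := R.combined_actsOn.reachable_smul g⁻¹ h'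
    rwa [inv_smul_smul, inv_smul_smul] at this

theorem combined_angleFine (hA : A.IsNAdmissible 2) : AngleFine R.combined := by
  refine (R.treeDecomposition hA).angleFine
    (fun w hw => AdmissibleAction.finite_neighborSet hA hw) ?_
  rintro v hv _ ⟨a, rfl⟩ _ ⟨b, rfl⟩ hab m
  have hfine := (R.isPeripheralGraph v (A.mem_V_iff.2 hv)).fine.angleFine a b
    ((R.combined_adj_iff a b).1 hab) m
  refine (hfine.image fun x => S.cls x.1).subset ?_
  rintro z ⟨haz, c, hc, hac, hcv⟩
  obtain ⟨b', c', rfl, hl, hs⟩ := R.exists_lift_walk c hcv b rfl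
  exact ⟨b', ⟨(R.combined_adj_iff a b').1 haz, c', hl.trans_le hc, fun h => hac (hs a h)⟩, rfl⟩

theorem combined_hyperbolic (hA : A.IsNAdmissible 2) : Hyperbolic R.combined := by
  obtain ⟨Q, hQ, hrep⟩ := A.finiteQuotient.1
  -- a constant for each white vertex; finitely many suffice
  have hyp : ∀ v, ∃ δ : ℕ, v ∈ A.V → ∀ x y z t : Fiber A.π v,
      (R.K v).dist x y + (R.K v).dist z t ≤
        max ((R.K v).dist x z + (R.K v).dist y t) ((R.K v).dist x t + (R.K v).dist y z) + δ := by
    intro v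
    by_cases hv : v ∈ A.V
    · obtain ⟨δ, hδ⟩ := (R.isPeripheralGraph v hv).hyperbolic
      exact ⟨δ, fun _ => hδ⟩
    · exact ⟨0, fun h => absurd h hv⟩
  choose δ hδ using hyp
  obtain ⟨C, hC⟩ := (hQ.image δ).bddAbove
  refine (R.treeDecomposition hA).hyperbolic (R.combined_connected hA) (δ := C) ?_
  intro v hv x hx y hy z hz t ht
  obtain ⟨u, hu, g, rfl⟩ := hrep v
  have huV : u ∈ A.V := A.mem_V_iff.2 fun h => hv (A.smul_mem_W g u h)
  obtain ⟨x, rfl⟩ := exists_smul_cls_eq hx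
  obtain ⟨y, rfl⟩ := exists_smul_cls_eq hy
  obtain ⟨z, rfl⟩ := exists_smul_cls_eq hz
  obtain ⟨t, rfl⟩ := exists_smul_cls_eq ht
  have h4 := hδ u huV x y z t
  have hCu := hC ⟨u, hu, rfl⟩
  simp only [R.combined_dist_smul, R.combined_dist hA]
  omega

/-- Each set `Λ_u` has finitely many orbits under the stabilizer of `u`, and the graph `K_u` has
finitely many orbits of edges. -/
theorem exists_finite_reps (u : U) :
    (∃ Q : Set (Fiber A.π u), Q.Finite ∧ ∀ x, ∃ y ∈ Q, ∃ g : stabilizer G u, g • y = x) ∧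
    ∃ E : Set (Fiber A.π u × Fiber A.π u), E.Finite ∧
      ∀ x y, (R.K u).Adj x y → ∃ e ∈ E, ∃ g : stabilizer G u, g • e = (x, y) := by
  by_cases hu : u ∈ A.W
  · have := A.finite u hu
    exact ⟨⟨Set.univ, Set.toFinite _, fun x => ⟨x, trivial, 1, one_smul _ x⟩⟩,
      ⟨Set.univ, Set.toFinite _, fun x y _ => ⟨(x, y), trivial, 1, one_smul _ _⟩⟩⟩
  · exact (R.isPeripheralGraph u (A.mem_V_iff.2 hu)).finiteQuotient

theorem combined_finiteQuotient : FiniteQuotient G R.combined := by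
  obtain ⟨Q, hQ, hrep⟩ := A.finiteQuotient.1
  choose P hP hPrep using fun u => (R.exists_finite_reps u).1
  choose E hE hErep using fun u => (R.exists_finite_reps u).2
  constructor
  · refine ⟨⋃ u ∈ Q, (fun a : Fiber A.π u => S.cls a.1) '' P u,
      hQ.biUnion fun u _ => (hP u).image _, fun p => ?_⟩
    obtain ⟨x, rfl⟩ := S.exists_cls p
    obtain ⟨u, hu, g, hg⟩ := hrep (A.π x)
    obtain ⟨a, ha⟩ := exists_smul_cls_eq (mem_piece.2 ⟨x, hg.symm, rfl⟩)
    obtain ⟨b, hb, k, rfl⟩ := hPrep u a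
    refine ⟨S.cls b.1, Set.mem_biUnion hu ⟨b, hb, rfl⟩, g * k.1, ?_⟩
    rw [mul_smul]
    exact ha
  · refine ⟨⋃ u ∈ Q, (fun e : Fiber A.π u × Fiber A.π u => (S.cls e.1.1, S.cls e.2.1)) '' E u,
      hQ.biUnion fun u _ => (hE u).image _, fun p q hpq => ?_⟩
    obtain ⟨-, u', a', b', ha', hb', -⟩ := id hpq
    obtain ⟨u, hu, g, rfl⟩ := hrep u'
    obtain ⟨a, rfl⟩ := exists_smul_cls_eq (ha' ▸ S.cls_mem_piece a')
    obtain ⟨b, rfl⟩ := exists_smul_cls_eq (hb' ▸ S.cls_mem_piece b')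
    have hab := R.combined_actsOn g⁻¹ _ _ hpq
    rw [inv_smul_smul, inv_smul_smul, R.combined_adj_iff] at hab
    obtain ⟨e, he, k, hk⟩ := hErep u a b hab
    obtain ⟨rfl, rfl⟩ := Prod.mk.inj hk
    refine ⟨_, Set.mem_biUnion hu ⟨e, he, rfl⟩, g * k.1, ?_⟩
    rw [mul_smul]
    rfl

/-- An edge of the combined graph comes from a red vertex graph, or from a white one in which it is
not a neck. Either way it comes from no other vertex graph of that colour, so its stabilizer fixes
a vertex of the tree. -/
theorem combined_finite_edge_stabilizer (hA : A.IsNAdmissible 2) (p q : S.Points)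
    (h : R.combined.Adj p q) : {g : G | s(g • p, g • q) = s(p, q)}.Finite := by
  obtain ⟨hne, u, a, b, rfl, rfl, hab, hn⟩ := h
  -- an element that preserves the edge also fixes `u`
  have hmem : ∀ g : G, s(g • S.cls a.1, g • S.cls b.1) = s(S.cls a.1, S.cls b.1) →
      S.cls a.1 ∈ S.piece (g • u) ∧ S.cls b.1 ∈ S.piece (g • u) := by
    intro g hg
    have h1 := smul_mem_piece g (S.cls_mem_piece a)
    have h2 := smul_mem_piece g (S.cls_mem_piece b)
    rcases Sym2.eq_iff.1 hg with ⟨e1, e2⟩ | ⟨e1, e2⟩ <;> rw [e1] at h1 <;> rw [e2] at h2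
    exacts [⟨h1, h2⟩, ⟨h2, h1⟩]
  by_cases hu : u ∈ A.W
  · refine (finite_setOf_smul_eq (AdmissibleAction.finite_stabilizer_of_red hA hu) u).subset ?_
    intro g hg
    obtain ⟨h1, h2⟩ := hmem g hg
    by_contra hgu
    exact hne (S.piece_red_inter (A.smul_mem_W g u hu) hu hgu
      ⟨h1, S.cls_mem_piece a⟩ ⟨h2, S.cls_mem_piece b⟩)
  · refine (((R.isPeripheralGraph u (A.mem_V_iff.2 hu)).finite_edge_stabilizer a b hab).image
      Subtype.val).subset ?_
    intro g hg
    obtain ⟨h1, h2⟩ := hmem g hg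
    have hgu : g • u = u := by
      by_contra hgu
      obtain ⟨w, huw, hsep⟩ := exists_adj_sep A.isTree (Ne.symm hgu)
      have hw : w ∈ A.W := by
        by_contra hw
        exact hu ((A.mem_W_iff_of_adj huw).2 hw)
      exact hn (isNeck_of_mem_piece hw huw hab.ne (S.piece_convex (S.cls_mem_piece a) h1 hsep)
        (S.piece_convex (S.cls_mem_piece b) h2 hsep))
    refine ⟨⟨g, hgu⟩, ?_, rfl⟩
    have hcls : ∀ x y : Fiber A.π u, g • S.cls x.1 = S.cls y.1 →
        (⟨g, hgu⟩ : stabilizer G u) • x = y := fun x y hxy => S.cls_injective u hxy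
    rcases Sym2.eq_iff.1 hg with ⟨e1, e2⟩ | ⟨e1, e2⟩
    · exact Sym2.eq_iff.2 (Or.inl ⟨hcls _ _ e1, hcls _ _ e2⟩)
    · exact Sym2.eq_iff.2 (Or.inr ⟨hcls _ _ e1, hcls _ _ e2⟩)

end VertexGraphs

variable (S) in
theorem exists_finite_forest_edges : ∃ E : Set (L × L), E.Finite ∧
    ∀ x y, S.forest.Adj x y → ∃ e ∈ E, ∃ g : G, g • e = (x, y) := by
  obtain ⟨Q, hQ, hrep⟩ := A.finiteQuotient.2
  let E : Set (L × L) := ⋃ e ∈ Q, {p | S.Rel p.1 p.2 ∧ A.π p.1 = e.1 ∧ A.π p.2 = e.2}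
  have hE : E.Finite := by
    refine hQ.biUnion fun e _ => ?_
    by_cases he : e.1 ∈ A.W
    · have := A.finite e.1 he
      refine Set.Finite.of_finite_image (f := Prod.fst)
        ((Set.finite_range fun z : Fiber A.π e.1 => z.1).subset ?_) ?_
      · rintro _ ⟨p, ⟨-, hp, -⟩, rfl⟩
        exact ⟨⟨p.1, hp⟩, rfl⟩
      · rintro ⟨x, y⟩ ⟨h1, -, h2⟩ ⟨x', y'⟩ ⟨h1', -, h2'⟩ hxx
        dsimp only at hxx h1 h1' h2 h2'
        subst hxx
        rw [forest_adj_inj h1.forest_adj h1'.forest_adj (h2.trans h2'.symm)]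
    · refine Set.finite_empty.subset ?_
      rintro p ⟨h, hp, -⟩
      exact he (hp ▸ h.adj.2)
  have hErep : ∀ x y, S.Rel x y → ∃ e ∈ E, ∃ g : G, g • e = (x, y) := by
    intro x y h
    obtain ⟨e, he, g, hg⟩ := hrep (A.π x) (A.π y) h.adj.1.symm
    refine ⟨(g⁻¹ • x, g⁻¹ • y), Set.mem_biUnion he ⟨h.smul g⁻¹, ?_, ?_⟩, g, by simp⟩
    · rw [map_smul, inv_smul_eq_iff]
      exact (congrArg Prod.fst hg).symm
    · rw [map_smul, inv_smul_eq_iff]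
      exact (congrArg Prod.snd hg).symm
  refine ⟨E ∪ Prod.swap '' E, hE.union (hE.image _), fun x y h => ?_⟩
  rw [forest, SimpleGraph.fromRel_adj] at h
  rcases h.2 with h | h
  · obtain ⟨e, he, g, hg⟩ := hErep x y h
    exact ⟨e, Or.inl he, g, hg⟩
  · obtain ⟨e, he, g, hg⟩ := hErep y x h
    exact ⟨e.swap, Or.inr ⟨e, he, rfl⟩, g, congrArg Prod.swap hg⟩

variable (S) in
/-- The stabilizer of a point of the quotient acts on a parabolic tree with finite quotient and
finitely generated vertex stabilizers. -/
theorem fg_stabilizer_points (p : S.Points) : (stabilizer G p).FG := by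
  obtain ⟨x, rfl⟩ := S.exists_cls p
  obtain ⟨E, hE, hrep⟩ := S.exists_finite_forest_edges
  refine fg_of_component (fun g _ _ h => S.forest_adj_smul g h) x _ (fun g => ?_) hE hrep
    A.fg_stabilizer
  rw [← S.cls_eq_cls_iff, mem_stabilizer_iff, smul_cls]
  exact eq_comm

theorem VertexGraphs.isPeripheralGraph_combined (hA : A.IsNAdmissible 2) (R : S.VertexGraphs) :
    IsPeripheralGraph G R.combined where
  actsOn := R.combined_actsOn
  finiteQuotient := R.combined_finiteQuotient
  connected := R.combined_connected hA
  fine := (R.combined_angleFine hA).fine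
  hyperbolic := R.combined_hyperbolic hA
  finite_edge_stabilizer := R.combined_finite_edge_stabilizer hA
  fg_vertex_stabilizer := S.fg_stabilizer_points

end Signature

end Combined

/-! ### Existence of equivariant systems of vertex graphs -/

section Existence

variable {G U L : Type*} [Group G] [MulAction G U] [MulAction G L] {A : AdmissibleAction G U L}

/-- Translation by `g` as a bijection between fibres. -/
def Fiber.translateEquiv (π : L →[G] U) (u : U) (g : G) : Fiber π u ≃ Fiber π (g • u) where
  toFun := Fiber.translate g
  invFun := fun x => ⟨g⁻¹ • x.1, by rw [map_smul, x.2, inv_smul_smul]⟩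
  left_inv := fun x => Subtype.ext (inv_smul_smul g x.1)
  right_inv := fun x => Subtype.ext (smul_inv_smul g x.1)

/-- Graphs on the fibres that are chosen for a set of representatives `u = ρ u` of the orbits can
be extended to an equivariant relation on all fibres. -/
theorem exists_equivariant_extension (π : L →[G] U) (K : ∀ u, SimpleGraph (Fiber π u))
    (hK : ∀ u, IsPeripheralGraph (stabilizer G u) (K u)) :
    ∃ E : L → L → Prop, (∀ (g : G) x y, E x y → E (g • x) (g • y)) ∧
      ∀ u, ∃ K' : SimpleGraph (Fiber π u), (∀ a b, K'.Adj a b ↔ E a.1 b.1) ∧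
        IsPeripheralGraph (stabilizer G u) K' := by
  -- representatives of the orbits
  obtain ⟨ρ, hρ, hρ'⟩ : ∃ ρ : U → U, (∀ u, ∃ g : G, g • ρ u = u) ∧
      ∀ (g : G) u, ρ (g • u) = ρ u := by
    refine ⟨fun u => (Quotient.mk (orbitRel G U) u).out, fun u => ?_, fun g u => ?_⟩
    · exact (Quotient.exact (Quotient.out_eq (Quotient.mk (orbitRel G U) u)).symm)
    · exact congrArg Quotient.out (Quotient.sound (s := orbitRel G U) ⟨g, rfl⟩)
  let E : L → L → Prop := fun x y => ∃ (g : G) (u : U) (a b : Fiber π u),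
    ρ u = u ∧ (K u).Adj a b ∧ g • a.1 = x ∧ g • b.1 = y
  let K' : ∀ u, SimpleGraph (Fiber π u) := fun u =>
    { Adj := fun a b => E a.1 b.1
      symm := ⟨fun a b ⟨g, u, x, y, hu, h, hx, hy⟩ => ⟨g, u, y, x, hu, h.symm, hy, hx⟩⟩
      loopless := ⟨fun a ⟨g, u, x, y, hu, h, hx, hy⟩ =>
        h.ne (Subtype.ext (MulAction.injective g (hx.trans hy.symm)))⟩ }
  have hadj : ∀ u, ρ u = u → ∀ (g : G) (a b : Fiber π u),
      (K' (g • u)).Adj (a.translate g) (b.translate g) ↔ (K u).Adj a b := by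
    intro u hu g a b
    constructor
    · rintro ⟨k, u', a', b', hu', hab, ha, hb⟩
      change k • a'.1 = g • a.1 at ha
      change k • b'.1 = g • b.1 at hb
      have huu := congrArg π ha
      rw [map_smul, map_smul, a.2, a'.2] at huu
      obtain rfl : u' = u := by rw [← hu', ← hρ' k u', huu, hρ' g u, hu]
      have hfix : (g⁻¹ * k) • u' = u' := by rw [mul_smul, huu, inv_smul_smul]
      have := (hK u').actsOn ⟨g⁻¹ * k, hfix⟩ _ _ hab
      have ea : (⟨g⁻¹ * k, hfix⟩ : stabilizer G u') • a' = a := Subtype.ext (by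
        change (g⁻¹ * k) • a'.1 = a.1
        rw [mul_smul, ha, inv_smul_smul])
      have eb : (⟨g⁻¹ * k, hfix⟩ : stabilizer G u') • b' = b := Subtype.ext (by
        change (g⁻¹ * k) • b'.1 = b.1
        rw [mul_smul, hb, inv_smul_smul])
      rwa [ea, eb] at this
    · exact fun h => ⟨g, u, a, b, hu, h, rfl, rfl⟩
  have hper : ∀ u, ρ u = u → ∀ g : G,
      IsPeripheralGraph (stabilizer G (g • u)) (K' (g • u)) := by
    intro u hu g
    let e : K u ≃g K' (g • u) :=
      { Fiber.translateEquiv π u g with map_rel_iff' := hadj u hu g _ _ }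
    refine (hK u).transport (stabilizerEquivStabilizer (g := g) rfl) e ?_
    intro k x
    apply Subtype.ext
    change g • k.1 • x.1 = (g * k.1 * g⁻¹) • g • x.1
    simp [mul_smul]
  refine ⟨E, ?_, fun u => ⟨K' u, fun a b => Iff.rfl, ?_⟩⟩
  · rintro k _ _ ⟨g, u, a, b, hu, h, rfl, rfl⟩
    exact ⟨k * g, u, a, b, hu, h, mul_smul _ _ _, mul_smul _ _ _⟩
  · obtain ⟨g, hg⟩ := hρ u
    have := hper (ρ u) ((hρ' g (ρ u)).symm.trans (congrArg ρ hg)) g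
    rwa [hg] at this

namespace Signature

variable (S : Signature A)

/-- The graph of the necks in `Λ_v`. -/
def neckGraph (v : U) : SimpleGraph (Fiber A.π v) where
  Adj a b := S.IsNeck a b
  symm := ⟨fun _ _ ⟨w, hw, h, x, y, hxy, hx, hy⟩ => ⟨w, hw, h, y, x, hxy.symm, hy, hx⟩⟩
  loopless := ⟨fun _ h => h.ne rfl⟩

theorem neckGraph_actsOn (v : U) : ActsOn (stabilizer G v) (S.neckGraph v) := by
  intro g a b h
  exact IsNeck.congr (a := a.translate g.1) (b := b.translate g.1) (a' := g • a) (b' := g • b)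
    rfl rfl (IsNeck.translate h g.1)

/-- There are finitely many orbits of necks in `Λ_v`. -/
theorem neckGraph_finite (v : U) : ∃ R : Set (Fiber A.π v × Fiber A.π v), R.Finite ∧
    ∀ a b, (S.neckGraph v).Adj a b → ∃ e ∈ R, ∃ g : stabilizer G v, g • e = (a, b) := by
  classical
  obtain ⟨Q, hQ, hrep⟩ := A.finiteQuotient.2
  -- representatives of the orbits of edges at `v`
  let c : U × U → U := fun e => if h : ∃ g : G, g • e.1 = v then h.choose • e.2 else e.2
  have hpiece : ∀ w ∈ A.W, (S.piece w).Finite := by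
    intro w hw
    have := A.finite w hw
    exact Set.finite_range _
  refine ⟨⋃ e ∈ Q ∩ {e | c e ∈ A.W},
    {ab | S.cls ab.1.1 ∈ S.piece (c e) ∧ S.cls ab.2.1 ∈ S.piece (c e)},
    (hQ.inter_of_left _).biUnion fun e he => ?_, fun a b hab => ?_⟩
  · have hfin := (hpiece _ he.2).preimage (S.cls_injective v).injOn
    exact (hfin.prod hfin).subset fun ab hab => ⟨hab.1, hab.2⟩
  · obtain ⟨w, hw, hvw, x, y, -, hx, hy⟩ := hab.mem_piece
    obtain ⟨e, he, g, hg⟩ := hrep v w hvw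
    have hex : ∃ g : G, g • e.1 = v := ⟨g, congrArg Prod.fst hg⟩
    have hc : c e = hex.choose • e.2 := dif_pos hex
    have hw' : (g * hex.choose⁻¹) • c e = w := by
      rw [hc, mul_smul, inv_smul_smul]
      exact congrArg Prod.snd hg
    have hv' : (g * hex.choose⁻¹) • v = v := by
      have h1 : hex.choose⁻¹ • v = e.1 := inv_smul_eq_iff.2 hex.choose_spec.symm
      rw [mul_smul, h1]
      exact congrArg Prod.fst hg
    let k : stabilizer G v := ⟨g * hex.choose⁻¹, hv'⟩
    have hmem : ∀ (a : Fiber A.π v) (x : Fiber A.π w), S.cls x.1 = S.cls a.1 →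
        S.cls (k⁻¹ • a).1 ∈ S.piece (c e) := by
      intro a x hxa
      have h1 := smul_mem_piece (g * hex.choose⁻¹)⁻¹ (hxa ▸ S.cls_mem_piece x)
      rwa [← hw', inv_smul_smul] at h1
    refine ⟨k⁻¹ • (a, b), Set.mem_biUnion (x := e) ⟨he, ?_⟩ ⟨hmem a x hx, hmem b y hy⟩, k,
      smul_inv_smul _ _⟩
    exact (A.smul_mem_W_iff _).1 (hw'.symm ▸ hw)

/-- The stabilizer of a neck fixes the unique red vertex from which the neck comes. -/
theorem neckGraph_finite_edge_stabilizer (hA : A.IsNAdmissible 2) {v : U} (a b : Fiber A.π v)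
    (h : (S.neckGraph v).Adj a b) :
    {g : stabilizer G v | s(g • a, g • b) = s(a, b)}.Finite := by
  obtain ⟨w, hw, hvw, x, y, hxy, hx, hy⟩ := h.mem_piece
  have hst := finite_setOf_smul_eq (AdmissibleAction.finite_stabilizer_of_red hA hw) w
  refine (hst.preimage Subtype.val_injective.injOn).subset fun g hg => ?_
  by_contra hgw
  have ha : S.cls a.1 ∈ S.piece w := hx ▸ S.cls_mem_piece x
  have hb : S.cls b.1 ∈ S.piece w := hy ▸ S.cls_mem_piece y
  have ha' : S.cls (g • a).1 ∈ S.piece (g.1 • w) := smul_mem_piece g.1 ha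
  have hb' : S.cls (g • b).1 ∈ S.piece (g.1 • w) := smul_mem_piece g.1 hb
  have hne : S.cls a.1 ≠ S.cls b.1 := fun e => h.ne (S.cls_injective v e)
  have hsub := S.piece_red_inter (A.smul_mem_W g.1 w hw) hw hgw
  rcases Sym2.eq_iff.1 hg with ⟨e1, e2⟩ | ⟨e1, e2⟩ <;> rw [e1] at ha' <;> rw [e2] at hb'
  · exact hne (hsub ⟨ha', ha⟩ ⟨hb', hb⟩)
  · exact hne (hsub ⟨hb', ha⟩ ⟨ha', hb⟩)

/-- Systems of vertex graphs exist: take any `(G_v, 𝒫_v)` graphs, equivariantly, and add the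
necks as edges. -/
theorem nonempty_vertexGraphs (hA : A.IsNAdmissible 2) : Nonempty S.VertexGraphs := by
  choose _ K hK using A.relativelyHyperbolic
  obtain ⟨E, hE, h⟩ := exists_equivariant_extension A.π K hK
  choose K' hK' hper using h
  have hEne : ∀ {u : U} {a b : Fiber A.π u}, E a.1 b.1 → a ≠ b := fun h =>
    ((hK' _ _ _).2 h).ne
  let R : ∀ u, SimpleGraph (Fiber A.π u) := fun u =>
    { Adj := fun a b => a ≠ b ∧ (u ∈ A.W ∨ (K' u ⊔ S.neckGraph u).Adj a b)
      symm := ⟨fun a b h => ⟨h.1.symm, h.2.imp_right fun h => h.symm⟩⟩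
      loopless := ⟨fun a h => h.1 rfl⟩ }
  have hRV : ∀ v ∈ A.V, R v = K' v ⊔ S.neckGraph v := by
    intro v hv
    ext a b
    exact ⟨fun h => h.2.resolve_left (A.mem_V_iff.1 hv), fun h => ⟨h.ne, Or.inr h⟩⟩
  refine ⟨⟨R, fun v hv => ?_, fun v hv a b hab => ?_, fun w hw => ?_, fun g u a b hab => ?_⟩⟩
  · rw [hRV v hv]
    exact (hper v).sup (S.neckGraph_actsOn v) (S.neckGraph_finite v)
      (S.neckGraph_finite_edge_stabilizer hA)
  · exact ⟨hab.ne, Or.inr (Or.inr hab)⟩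
  · ext a b
    exact ⟨fun h => h.1, fun h => ⟨h, Or.inl hw⟩⟩
  · refine ⟨fun e => hab.1 (Subtype.ext (MulAction.injective g (congrArg Subtype.val e))), ?_⟩
    rcases hab.2 with h | h | h
    · exact Or.inl (A.smul_mem_W g u h)
    · exact Or.inr (Or.inl ((hK' _ _ _).2 (hE g _ _ ((hK' _ _ _).1 h))))
    · exact Or.inr (Or.inr (IsNeck.translate h g))

end Signature

end Existence

end ParabolicCombination

open ParabolicCombination in
theorem theorem3p5 {G U L : Type*} [Group G] [MulAction G U] [MulAction G L]
    (A : AdmissibleAction G U L) (hA : A.IsNAdmissible 2) (S : Signature A) :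
    -- the pair consisting of `G` and the stabilizers of the points of the quotient is
    -- relatively hyperbolic
    RelativelyHyperbolic G S.Points ∧
    -- reservoirs can be chosen equivariantly, and for every such choice:
    Nonempty S.VertexGraphs ∧
    (∀ R : S.VertexGraphs,
      -- the combined graph is a `(G, 𝒫)` graph
      IsPeripheralGraph G R.combined ∧
      -- each vertex graph is a convex subgraph of it
      (∀ u : U, IsConvexSubgraph (R.K u) R.combined fun x => S.cls x.1) ∧
      -- if the Bowditch boundary is connected, each red pair separates graph and boundary
      (ConnectedSpace (Delta R.combined) → ∀ w ∈ A.W,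
        SeparatesGraph R.combined (S.piece w) ∧
        SeparatesSpace ((Delta.vertex : S.Points → Delta R.combined) '' S.piece w))) ∧
    -- the parabolic forest is a forest, and the points of the quotient correspond equivariantly
    -- to its components, with the same stabilizers
    S.forest.IsAcyclic ∧
    ∃ φ : S.Points ≃ S.ParabolicTree,
      (∀ x : L, φ (S.cls x) = S.treeOf x) ∧
      (∀ (g : G) (p : S.Points), φ (g • p) = g • φ p) ∧
      ∀ p : S.Points, MulAction.stabilizer G p = MulAction.stabilizer G (φ p) := by
  have hne := S.nonempty_vertexGraphs hA
  have hper := fun R : S.VertexGraphs => R.isPeripheralGraph_combined hA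
  refine ⟨⟨A.fg, ?_⟩, hne, fun R => ⟨hper R, R.isConvexSubgraph hA, fun _ w hw => ?_⟩,
    S.forest_isAcyclic, S.exists_equiv⟩
  · obtain ⟨R⟩ := hne
    exact ⟨R.combined, hper R⟩
  · exact (R.treeDecomposition hA).separates (R.combined_connected hA) hw
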